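/- Let $d\ge 2$ and let $(\tau_e)$ be independent, identically distributed, non-negative random variables indexed by the nearest-neighbour edges $e$ of $\mathbb{Z}^d$. A path is a finite sequence of vertices of $\mathbb{Z}^d$ in which consecutive vertices are at $\ell^1$-distance $1$; its passage time $\mathrm{T}(\gamma)$ is the sum of $\tau_e$ over its edges. For $x,y\in\mathbb{R}^d$ let $\mathrm{T}(x,y)=\inf_\gamma \mathrm{T}(\gamma)$, the infimum being over all paths $\gamma$ from $\lfloor x\rfloor$ to $\lfloor y\rfloor$ (integer parts taken coordinatewise). Let $p_c(d)$ be the critical probability of Bernoulli bond percolation on $\mathbb{Z}^d$, and let $\mu(x)=\lim_{t\to\infty}t^{-1}\mathbb{E}[\mathrm{T}(0,tx)]$ be the time constant. (i) Suppose that $\mathbb{P}(\tau_e=0)<p_c(d)$ and that there are constants $c_1,c_2,\alpha>0$ and $r\in(0,1]$ such that, for all sufficiently large $t$, $$c_1e^{-\alpha t^r}\le \mathbb{P}(\tau_e>t)\le c_2e^{-\alpha t^r}.$$ Then for every $x\in\mathbb{R}^d\setminus\{0\}$ the variables $\mathrm{T}(0,tx)$ are integrable, the limit defining $\mu(x)$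 exists and is finite, and for every $\xi>0$ $$\lim_{n\to\infty}\frac1{n^r}\log\mathbb{P}\bigl(\mathrm{T}(0,nx)>n(\mu(x)+\xi)\bigr)=-2d\alpha\xi^r .$$ (ii) In particular, if the $\tau_e$ are exponentially distributed with rate $\alpha>0$ (the Eden growth model), then for every $x\in\mathbb{R}^d\setminus\{0\}$ and $\xi>0$ $$\lim_{n\to\infty}\frac1{n}\log\mathbb{P}\bigl(\mathrm{T}(0,nx)>n(\mu(x)+\xi)\bigr)=-2d\alpha\xi .$$ -/

import Mathlib

open MeasureTheory ProbabilityTheory Filter Topology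

namespace FPP

/-- The nearest-neighbour lattice on `ℤ^d`: `x ~ y` iff `|x - y|₁ = 1`. -/
def lattice (d : ℕ) : SimpleGraph (Fin d → ℤ) where
  Adj x y := ∑ i, |x i - y i| = 1
  symm := ⟨fun x y h => by simpa only [abs_sub_comm] using h⟩
  loopless := ⟨fun x h => by simp at h⟩

/-- The set of (undirected) nearest-neighbour edges of `ℤ^d`. -/
abbrev Edge (d : ℕ) : Type := (lattice d).edgeSet

/-- The probability that the open cluster of the origin is infinite in Bernoulli bond percolation
on `ℤ^d`, in which each nearest-neighbour edge is open independently with probability `p`. -/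
noncomputable def percolationProb (d : ℕ) (p : unitInterval) : ℝ :=
  (setBernoulli (lattice d).edgeSet p).real
    {S : Set (Sym2 (Fin d → ℤ)) | {y | (SimpleGraph.fromEdgeSet S).Reachable 0 y}.Infinite}

/-- The critical probability of Bernoulli bond percolation on `ℤ^d`: the supremum of all
`p ∈ [0, 1]` for which the open cluster of the origin is almost surely finite. -/
noncomputable def criticalProb (d : ℕ) : ℝ :=
  sSup {p : ℝ | ∃ hp : p ∈ unitInterval, percolationProb d ⟨p, hp⟩ = 0}

/-- The passage time of a nearest-neighbour path: the sum of the weights of its edges. (An edge is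
counted as often as it is traversed. For non-negative weights this does not affect the infimum over
all paths with given endpoints, which may be taken over self-avoiding paths.) -/
def pathTime {d : ℕ} (w : Edge d → ℝ) :
    {x y : Fin d → ℤ} → (lattice d).Walk x y → ℝ
  | _, _, .nil => 0
  | x, _, .cons (v := z) h γ => w ⟨s(x, z), h⟩ + pathTime w γ

/-- The coordinatewise integer part of a point of `ℝ^d`. -/
noncomputable def floorPt {d : ℕ} (x : Fin d → ℝ) : Fin d → ℤ := fun i => ⌊x i⌋

/-- The first passage time `T(x, y)`: the infimum of the passage times of all finite
nearest-neighbour paths from `⌊x⌋` to `⌊y⌋`. -/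
noncomputable def passageTime {d : ℕ} (w : Edge d → ℝ) (x y : Fin d → ℝ) : ℝ :=
  ⨅ γ : (lattice d).Walk (floorPt x) (floorPt y), pathTime w γ

/-- The time constant `μ(x) = lim_{t → ∞} t⁻¹ E[T(0, t x)]`. -/
noncomputable def timeConstant {d : ℕ} {Ω : Type*} [MeasurableSpace Ω] (P : Measure Ω)
    (τ : Edge d → Ω → ℝ) (x : Fin d → ℝ) : ℝ :=
  limUnder atTop fun t : ℝ => t⁻¹ * ∫ ω, passageTime (fun e => τ e ω) 0 (t • x) ∂P

end FPP

/-!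
The weights have tails of order `exp (-α t ^ r)` with `r ≤ 1`. Since `(a + b) ^ r ≤ a ^ r + b ^ r`,
the cheapest way of delaying the passage from `0` to `⌊n x⌋` by `n ξ` is to concentrate the whole
delay on the edges at one of the two endpoints. There are `2d` edges at a site, so the cost is
`2dα (n ξ) ^ r`. The argument takes place under the product law `envLaw d ν` of the weights, and the
result is transferred to the given probability space by `map_eq_map_envLaw`.

*Lower bound* (`eventually_le_upper_tail`). All `2d` edges at the origin exceed `n (ξ + 2ε)` with
probability about `exp (-2dα (n (ξ + 2ε)) ^ r)`. Independently of this, the passage time in the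
configuration where these edges have weight `0` is at least `n (μ - ε)` with probability tending to
`1`: this is a weak law of large numbers (`tendsto_lower_tail`), which follows from the convergence
of the means, a bound on the second moment, and the upper bound below.

*Upper bound* (`eventually_upper_tail_le`). The segment from `0` to `⌊n x⌋` is cut into steps of a
large constant length, and the passage time of each step is replaced by the minimum over a finite
set of walks (`exists_local_bound`), which costs little in the mean. The sum over the steps depends
only on the weights in a tube of bounded width, and by a truncated Chernoff bound
(`exists_upper_tail_sum`) it exceeds `n (μ + ε)` with probability at most `A n exp (-c n ^ r)`,
possibly with a small `c` (`exists_tube`). But there is room for arbitrarily many disjoint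
translates of the tube, at bounded distance from each other; they are independent, so the
probability that all of them are slow decays at any prescribed rate (`exists_translates`). If one
of them is fast, the excess `n ξ` has to be spent on the way from `0` to its start or from its end
to `⌊n x⌋`. As `0` is joined to any site `L e_b` by `2d` edge-disjoint paths
(`exists_disjoint_paths`), each of these two independent delays `D` satisfies
`E exp (β D ^ r) < ∞` for all `β < 2dα` (`exists_hub`), and so does their sum.

The hypothesis on the atom of the weights at `0` only ensures that the time constant is positive.
This plays no role in the argument, so that exponential weights are covered without any estimate of
the critical probability.
-/

namespace FPP

/-! ### Independence of functions of disjoint sets of coordinates -/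

section Coordinates

variable {ι : Type*}

/-- A measurable function that depends only on the coordinates in `S` is a measurable function of
the restriction to `S`. -/
lemma exists_measurable_comp_of_dependsOn {β : Type*} [MeasurableSpace β] {S : Set ι}
    {f : (ι → ℝ) → β} (hf : Measurable f) (hS : DependsOn f S) :
    ∃ φ : (S → ℝ) → β, Measurable φ ∧ f = fun w => φ fun i => w i := by
  classical
  refine ⟨fun v => f fun i => if h : i ∈ S then v ⟨i, h⟩ else 0, hf.comp ?_, ?_⟩
  · refine measurable_pi_iff.2 fun i => ?_
    by_cases h : i ∈ S
    · simpa [h] using measurable_pi_apply (⟨i, h⟩ : S)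
    · simp [h]
  · ext1 w
    exact hS fun i hi => by simp [hi]

/-- Under a product measure, functions of pairwise disjoint sets of coordinates are independent. -/
lemma iIndepFun_of_dependsOn (ν : Measure ℝ) [IsProbabilityMeasure ν] {κ : Type*} {β : Type*}
    [MeasurableSpace β] {f : κ → (ι → ℝ) → β} {S : κ → Set ι} (hf : ∀ k, Measurable (f k))
    (hS : ∀ k, DependsOn (f k) (S k)) (hdisj : Pairwise fun k l => Disjoint (S k) (S l)) :
    iIndepFun f (Measure.infinitePi fun _ : ι => ν) := by
  choose φ hφ hfφ using fun k => exists_measurable_comp_of_dependsOn (hf k) (hS k)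
  have hinj : Function.Injective fun p : (k : κ) × S k => (p.2 : ι) := by
    rintro ⟨k, i, hi⟩ ⟨l, j, hj⟩ (h : i = j)
    subst h
    obtain rfl : k = l := by
      by_contra hkl
      exact Set.disjoint_left.1 (hdisj hkl) hi hj
    rfl
  have hlaw : (Measure.infinitePi fun _ : ι => ν).map (fun w (k : κ) (i : S k) => w i) =
      Measure.infinitePi fun k : κ => Measure.infinitePi fun _ : S k => ν := by
    rw [← Measure.infinitePi_map_piCurry (X := fun (k : κ) (_ : S k) => ℝ)
      (μ := fun (k : κ) (_ : S k) => ν),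
      ← Measure.map_infinitePi_infinitePi_of_inj (P := fun _ : ι => ν) hinj,
      Measure.map_map (by fun_prop) (by fun_prop)]
    rfl
  have hrestr : iIndepFun (fun (k : κ) (w : ι → ℝ) (i : S k) => w i)
      (Measure.infinitePi fun _ : ι => ν) := by
    rw [iIndepFun_iff_map_fun_eq_infinitePi_map (by fun_prop), hlaw]
    congr 1
    ext1 k
    exact (Measure.map_infinitePi_infinitePi_of_inj (P := fun _ : ι => ν)
      Subtype.val_injective).symm
  rw [show f = fun k => φ k ∘ fun w i => w i from funext hfφ]
  exact hrestr.comp φ hφ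

end Coordinates

/-! ### Passage times of sites -/

variable {d : ℕ}

/-- A configuration of weights. For convenience every unordered pair of sites carries a weight; only
the weights of nearest-neighbour pairs are ever used. -/
abbrev Env (d : ℕ) : Type := Sym2 (Fin d → ℤ) → ℝ

/-- The sum of the weights along a walk. -/
def walkTime (W : Env d) {x y : Fin d → ℤ} (γ : (lattice d).Walk x y) : ℝ :=
  (γ.edges.map W).sum

/-- The first passage time between two sites. -/
noncomputable def siteTime (W : Env d) (x y : Fin d → ℤ) : ℝ :=
  ⨅ γ : (lattice d).Walk x y, walkTime W γ

/-- The translation of unordered pairs of sites by `z`. -/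
def shiftEdge (z : Fin d → ℤ) : Sym2 (Fin d → ℤ) → Sym2 (Fin d → ℤ) := Sym2.map (· + z)

/-- The configuration `W` seen from `z`. -/
def shiftEnv (z : Fin d → ℤ) (W : Env d) : Env d := fun e => W (shiftEdge z e)

lemma pathTime_eq_walkTime (W : Env d) {x y : Fin d → ℤ} (γ : (lattice d).Walk x y) :
    pathTime (fun e : Edge d => W e) γ = walkTime W γ := by
  induction γ with
  | nil => simp [pathTime, walkTime]
  | cons h γ ih => simp [pathTime, walkTime] at ih ⊢; exact ih

lemma walkTime_nonneg {W : Env d} (hW : ∀ e, 0 ≤ W e) {x y : Fin d → ℤ}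
    (γ : (lattice d).Walk x y) : 0 ≤ walkTime W γ :=
  List.sum_nonneg (by simpa using fun e _ => hW e)

lemma bddBelow_walkTime {W : Env d} (hW : ∀ e, 0 ≤ W e) (x y : Fin d → ℤ) :
    BddBelow (Set.range fun γ : (lattice d).Walk x y => walkTime W γ) :=
  ⟨0, by rintro _ ⟨γ, rfl⟩; exact walkTime_nonneg hW γ⟩

lemma siteTime_le {W : Env d} (hW : ∀ e, 0 ≤ W e) {x y : Fin d → ℤ}
    (γ : (lattice d).Walk x y) : siteTime W x y ≤ walkTime W γ :=
  ciInf_le (bddBelow_walkTime hW x y) γ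

lemma siteTime_nonneg {W : Env d} (hW : ∀ e, 0 ≤ W e) (x y : Fin d → ℤ) :
    0 ≤ siteTime W x y :=
  Real.iInf_nonneg fun γ => walkTime_nonneg hW γ

@[simp] lemma walkTime_append (W : Env d) {x y z : Fin d → ℤ} (γ : (lattice d).Walk x y)
    (γ' : (lattice d).Walk y z) :
    walkTime W (γ.append γ') = walkTime W γ + walkTime W γ' := by
  simp [walkTime]

@[simp] lemma walkTime_reverse (W : Env d) {x y : Fin d → ℤ} (γ : (lattice d).Walk x y) :
    walkTime W γ.reverse = walkTime W γ := by
  simp [walkTime, List.map_reverse, List.sum_reverse]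

lemma walkTime_bypass_le {W : Env d} (hW : ∀ e, 0 ≤ W e) {x y : Fin d → ℤ}
    (γ : (lattice d).Walk x y) : walkTime W γ.bypass ≤ walkTime W γ :=
  (γ.edges_bypass_sublist_edges.map W).sum_le_sum (by simpa using fun e _ => hW e)

lemma siteTime_comm (W : Env d) (x y : Fin d → ℤ) : siteTime W x y = siteTime W y x := by
  have h (x y : Fin d → ℤ) : Set.range (fun γ : (lattice d).Walk x y => walkTime W γ) ⊆
      Set.range fun γ : (lattice d).Walk y x => walkTime W γ := by
    rintro _ ⟨γ, rfl⟩
    exact ⟨γ.reverse, by simp⟩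
  exact congrArg sInf (Set.Subset.antisymm (h x y) (h y x))

/-- Translation by `z` as an endomorphism of the lattice. -/
def shiftHom (z : Fin d → ℤ) : lattice d →g lattice d where
  toFun y := y + z
  map_rel' {x y} h := by simpa [lattice] using h

lemma walkTime_map_shiftHom (W : Env d) (z : Fin d → ℤ) {x y : Fin d → ℤ}
    (γ : (lattice d).Walk x y) :
    walkTime W (γ.map (shiftHom z)) = walkTime (shiftEnv z W) γ := by
  simp only [walkTime, SimpleGraph.Walk.edges_map, List.map_map]
  rfl

lemma shiftEdge_shiftEdge (z z' : Fin d → ℤ) (e : Sym2 (Fin d → ℤ)) :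
    shiftEdge z (shiftEdge z' e) = shiftEdge (z' + z) e := by
  simp only [shiftEdge, Sym2.map_map]
  congr 1
  ext1 y
  simp [add_assoc]

@[simp] lemma shiftEdge_zero (e : Sym2 (Fin d → ℤ)) : shiftEdge 0 e = e := by
  simp [shiftEdge]

lemma shiftEdge_injective (z : Fin d → ℤ) : Function.Injective (shiftEdge z) :=
  Sym2.map.injective (add_left_injective z)

lemma mem_shiftEdge {z y : Fin d → ℤ} {e : Sym2 (Fin d → ℤ)} :
    y ∈ shiftEdge z e ↔ y - z ∈ e := by
  simp only [shiftEdge, Sym2.mem_map]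
  exact ⟨by rintro ⟨a, ha, rfl⟩; simpa using ha, fun h => ⟨_, h, by simp⟩⟩

lemma siteTime_shiftEnv (W : Env d) (z x y : Fin d → ℤ) :
    siteTime (shiftEnv z W) x y = siteTime W (x + z) (y + z) := by
  refine congrArg sInf (Set.Subset.antisymm ?_ ?_)
  · rintro _ ⟨γ, rfl⟩
    exact ⟨γ.map (shiftHom z), walkTime_map_shiftHom W z γ⟩
  · rintro _ ⟨γ, rfl⟩
    have hx (x : Fin d → ℤ) : shiftHom (-z) (x + z) = x := by simp [shiftHom]
    refine ⟨(γ.map (shiftHom (-z))).copy (hx x) (hx y), ?_⟩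
    have : walkTime (shiftEnv z W) ((γ.map (shiftHom (-z))).copy (hx x) (hx y)) =
        walkTime (shiftEnv z W) (γ.map (shiftHom (-z))) := by
      simp [walkTime]
    simp only [this]
    rw [walkTime_map_shiftHom]
    congr 1
    ext1 e
    simp [shiftEnv, shiftEdge_shiftEdge]

/-- Any two sites are joined by a walk whose length is at most their `ℓ¹`-distance. -/
lemma exists_walk_length_le (x y : Fin d → ℤ) :
    ∃ γ : (lattice d).Walk x y, (γ.length : ℤ) ≤ ∑ i, |x i - y i| := by
  obtain ⟨n, hn⟩ : ∃ n : ℕ, (n : ℤ) = ∑ i, |x i - y i| :=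
    ⟨(∑ i, |x i - y i|).toNat, Int.toNat_of_nonneg (Finset.sum_nonneg fun i _ => abs_nonneg _)⟩
  induction n generalizing x with
  | zero =>
    have : x = y := by
      ext i
      have := (Finset.sum_eq_zero_iff_of_nonneg (fun i _ => abs_nonneg (x i - y i))).1
        (by simpa using hn.symm) i (Finset.mem_univ i)
      rwa [abs_eq_zero, sub_eq_zero] at this
    subst this
    exact ⟨.nil, by simp⟩
  | succ n ih =>
    obtain ⟨i, -, hi⟩ : ∃ i ∈ Finset.univ, |x i - y i| ≠ 0 :=
      Finset.exists_ne_zero_of_sum_ne_zero (by rw [← hn]; positivity)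
    have hi : x i - y i ≠ 0 := by simpa using hi
    -- one step from `x` towards `y` in a coordinate where they differ
    let z : Fin d → ℤ := Function.update x i (x i - (x i - y i).sign)
    have hzi : z i = x i - (x i - y i).sign := by simp [z]
    have hzj (j) (hj : j ≠ i) : z j = x j := by simp [z, hj]
    have hsum (f g : Fin d → ℤ) (h : ∀ j, j ≠ i → f j = g j) :
        ∑ j, f j - ∑ j, g j = f i - g i := by
      rw [← Finset.sum_sub_distrib]
      exact Finset.sum_eq_single_of_mem i (Finset.mem_univ i)
        fun j _ hj => by rw [h j hj, sub_self]
    have hs : |(x i - y i).sign| = 1 := by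
      rcases lt_or_gt_of_ne hi with h | h
      · simp [Int.sign_eq_neg_one_of_neg h]
      · simp [Int.sign_eq_one_of_pos h]
    have hadj : (lattice d).Adj x z := by
      have := hsum (fun j => |x j - z j|) (fun _ => 0) fun j hj => by simp [hzj j hj]
      simp only [lattice]
      rw [Finset.sum_const_zero, sub_zero, hzi] at this
      rw [this]
      simpa using hs
    have hn' : (n : ℤ) = ∑ j, |z j - y j| := by
      have := hsum (fun j => |z j - y j|) (fun j => |x j - y j|) fun j hj => by simp [hzj j hj]
      rw [← hn] at this
      push_cast at this
      have h1 : |z i - y i| - |x i - y i| = -1 := by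
        rw [hzi]
        rcases lt_or_gt_of_ne hi with h | h
        · rw [Int.sign_eq_neg_one_of_neg h, abs_of_neg h, abs_of_nonpos] <;> omega
        · rw [Int.sign_eq_one_of_pos h, abs_of_pos h, abs_of_nonneg] <;> omega
      rw [h1] at this
      linarith
    obtain ⟨γ, hγ⟩ := ih z hn'
    refine ⟨.cons hadj γ, ?_⟩
    rw [← hn, SimpleGraph.Walk.length_cons]
    rw [← hn'] at hγ
    push_cast
    omega

instance nonempty_walk (x y : Fin d → ℤ) : Nonempty ((lattice d).Walk x y) :=
  ⟨(exists_walk_length_le x y).choose⟩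

instance countable_walk (x y : Fin d → ℤ) : Countable ((lattice d).Walk x y) := by
  refine Function.Injective.countable (f := fun γ => γ.support) ?_
  intro γ γ' h
  exact SimpleGraph.Walk.ext_support h

/-- The triangle inequality for passage times. -/
lemma siteTime_triangle {W : Env d} (hW : ∀ e, 0 ≤ W e) (x y z : Fin d → ℤ) :
    siteTime W x z ≤ siteTime W x y + siteTime W y z := by
  refine le_ciInf_add_ciInf fun γ γ' => ?_
  simpa using siteTime_le hW (γ.append γ')

lemma siteTime_self {W : Env d} (hW : ∀ e, 0 ≤ W e) (x : Fin d → ℤ) : siteTime W x x = 0 :=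
  le_antisymm (by simpa [walkTime] using siteTime_le hW (.nil : (lattice d).Walk x x))
    (siteTime_nonneg hW x x)

lemma siteTime_le_sum {W : Env d} (hW : ∀ e, 0 ≤ W e) (p : ℕ → Fin d → ℤ) (m : ℕ) :
    siteTime W (p 0) (p m) ≤ ∑ k ∈ Finset.range m, siteTime W (p k) (p (k + 1)) := by
  induction m with
  | zero => simp [siteTime_self hW]
  | succ m ih =>
    rw [Finset.sum_range_succ]
    exact (siteTime_triangle hW _ (p m) _).trans (by gcongr)

/-! ### The product law of the weights -/

section Law

@[fun_prop]
lemma measurable_walkTime {x y : Fin d → ℤ} (γ : (lattice d).Walk x y) :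
    Measurable fun W : Env d => walkTime W γ := by
  unfold walkTime
  induction γ.edges with
  | nil => simp
  | cons e l ih =>
    simp only [List.map_cons, List.sum_cons]
    exact (measurable_pi_apply e).add ih

@[fun_prop]
lemma measurable_siteTime (x y : Fin d → ℤ) : Measurable fun W : Env d => siteTime W x y :=
  Measurable.iInf fun γ => measurable_walkTime γ

@[fun_prop]
lemma measurable_shiftEnv (z : Fin d → ℤ) : Measurable (shiftEnv z) :=
  measurable_pi_iff.2 fun _ => measurable_pi_apply _

lemma dependsOn_walkTime {x y : Fin d → ℤ} (γ : (lattice d).Walk x y) :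
    DependsOn (fun W : Env d => walkTime W γ) {e | e ∈ γ.edges} := by
  intro W W' h
  simp only [walkTime]
  rw [List.map_congr_left h]

lemma dependsOn_comp_shiftEnv {β : Type*} {X : Env d → β} {S : Set (Sym2 (Fin d → ℤ))}
    (hX : DependsOn X S) (z : Fin d → ℤ) :
    DependsOn (fun W => X (shiftEnv z W)) (shiftEdge z '' S) :=
  fun _ _ h => hX fun e he => h _ ⟨e, he, rfl⟩

/-- The law of independent weights with common distribution `ν`. -/
noncomputable def envLaw (d : ℕ) (ν : Measure ℝ) : Measure (Env d) :=
  Measure.infinitePi fun _ => ν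

variable (ν : Measure ℝ) [IsProbabilityMeasure ν]

instance : IsProbabilityMeasure (envLaw d ν) := by unfold envLaw; infer_instance

lemma measurePreserving_shiftEnv (z : Fin d → ℤ) :
    MeasurePreserving (shiftEnv z) (envLaw d ν) (envLaw d ν) :=
  ⟨measurable_shiftEnv z,
    Measure.map_infinitePi_infinitePi_of_inj (P := fun _ => ν) (shiftEdge_injective z)⟩

lemma measurePreserving_eval (e : Sym2 (Fin d → ℤ)) :
    MeasurePreserving (fun W : Env d => W e) (envLaw d ν) ν :=
  measurePreserving_eval_infinitePi (fun _ => ν) e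

lemma ae_nonneg (hν : ∀ᵐ t ∂ν, 0 ≤ t) : ∀ᵐ W ∂(envLaw d ν), ∀ e, 0 ≤ W e :=
  ae_all_iff.2 fun e => (measurePreserving_eval ν e).quasiMeasurePreserving.ae hν

end Law

/-! ### Stretched exponential moments -/

section StretchedMoments

variable {Ω : Type*} [MeasurableSpace Ω] {P : Measure Ω}

lemma measureReal_lt_le_exp_mul_integral [IsFiniteMeasure P] {X : Ω → ℝ} {β r s : ℝ} (hβ : 0 ≤ β)
    (hr : 0 ≤ r) (hs : 0 ≤ s) (hint : Integrable (fun ω => Real.exp (β * X ω ^ r)) P) :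
    P.real {ω | s < X ω} ≤ Real.exp (-β * s ^ r) * ∫ ω, Real.exp (β * X ω ^ r) ∂P := by
  have h1 : P.real {ω | s < X ω} ≤
      P.real {ω | Real.exp (β * s ^ r) ≤ Real.exp (β * X ω ^ r)} := by
    refine measureReal_mono fun ω (hω : s < X ω) => ?_
    have := Real.rpow_le_rpow hs hω.le hr
    simp only [Set.mem_ofPred_eq]
    gcongr
  have h2 := mul_meas_ge_le_integral_of_nonneg (ae_of_all _ fun ω => (Real.exp_pos _).le) hint
    (Real.exp (β * s ^ r))
  rw [neg_mul, Real.exp_neg, ← div_eq_inv_mul, le_div_iff₀ (Real.exp_pos _), mul_comm]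
  exact (mul_le_mul_of_nonneg_left h1 (Real.exp_pos _).le).trans h2

/-- A tail of order `exp (-α t ^ r)` gives a finite moment `E exp (β X ^ r)` for each `β < α`. -/
lemma integrable_exp_of_tail [IsFiniteMeasure P] {X : Ω → ℝ} (hX : Measurable X)
    (h0 : ∀ᵐ ω ∂P, 0 ≤ X ω) {α β r C : ℝ} (hr : 0 < r) (hβ : 0 ≤ β) (hβα : β < α)
    (htail : ∀ᶠ t : ℝ in atTop, P.real {ω | t < X ω} ≤ C * Real.exp (-α * t ^ r)) :
    Integrable (fun ω => Real.exp (β * X ω ^ r)) P := by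
  have hmeas : Measurable fun ω => Real.exp (β * X ω ^ r) := by fun_prop
  refine ⟨hmeas.aestronglyMeasurable, ?_⟩
  rw [hasFiniteIntegral_iff_ofReal (ae_of_all _ fun ω => (Real.exp_pos _).le)]
  -- compare `exp (β X ^ r)` with a sum over the integers `k < X ^ r`
  have hpt : ∀ᵐ ω ∂P, ENNReal.ofReal (Real.exp (β * X ω ^ r)) ≤ 1 + ∑' k : ℕ,
      ({ω | (k : ℝ) < X ω ^ r}).indicator
        (fun _ => ENNReal.ofReal (Real.exp (β * (k + 1)))) ω := by
    filter_upwards [h0] with ω hω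
    have hY : 0 ≤ X ω ^ r := Real.rpow_nonneg hω r
    rcases hY.eq_or_lt with h | h
    · rw [← h]; simp
    · have hk := Nat.ceil_pos.2 h
      obtain ⟨k, hk'⟩ := Nat.exists_eq_succ_of_ne_zero hk.ne'
      have h1 : X ω ^ r ≤ k + 1 := by
        have := Nat.le_ceil (X ω ^ r); rw [hk'] at this; push_cast at this; exact this
      have h2 : (k : ℝ) < X ω ^ r := Nat.lt_ceil.1 (by omega)
      refine le_add_left (le_trans ?_ (ENNReal.le_tsum k))
      rw [Set.indicator_of_mem (by exact h2)]
      gcongr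
  have hset (k : ℕ) : MeasurableSet {ω | (k : ℝ) < X ω ^ r} :=
    measurableSet_lt measurable_const (by fun_prop)
  refine (lintegral_mono_ae hpt).trans_lt ?_
  rw [lintegral_add_left measurable_const, lintegral_tsum
    fun k => (measurable_const.indicator (hset k)).aemeasurable]
  refine ENNReal.add_lt_top.2 ⟨by simp, ?_⟩
  simp only [lintegral_indicator (hset _), lintegral_const, Measure.restrict_apply_univ]
  have hterm (k : ℕ) : ENNReal.ofReal (Real.exp (β * (k + 1))) * P {ω | (k : ℝ) < X ω ^ r} =
      ENNReal.ofReal (Real.exp (β * (k + 1)) * P.real {ω | (k : ℝ) < X ω ^ r}) := by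
    rw [ENNReal.ofReal_mul (Real.exp_pos _).le, ofReal_measureReal]
  simp only [hterm]
  have hsum : Summable fun k : ℕ =>
      Real.exp (β * (k + 1)) * P.real {ω | (k : ℝ) < X ω ^ r} := by
    have hgeo : Summable fun k : ℕ => (C * Real.exp β) * Real.exp (-(α - β)) ^ k :=
      (summable_geometric_of_lt_one (Real.exp_pos _).le
        (Real.exp_lt_one_iff.2 (by linarith))).mul_left _
    refine Summable.of_norm_bounded_eventually_nat hgeo ?_
    have hroot : Tendsto (fun k : ℕ => (k : ℝ) ^ (1 / r)) atTop atTop :=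
      (tendsto_rpow_atTop (by positivity)).comp tendsto_natCast_atTop_atTop
    filter_upwards [hroot.eventually htail] with k hk
    rw [Real.norm_of_nonneg (by positivity)]
    have h1 : P.real {ω | (k : ℝ) < X ω ^ r} ≤ P.real {ω | (k : ℝ) ^ (1 / r) < X ω} := by
      refine ENNReal.toReal_mono (measure_ne_top _ _) (measure_mono_ae ?_)
      filter_upwards [h0] with ω hω hkω
      have hkω : (k : ℝ) < X ω ^ r := hkω
      have := Real.rpow_lt_rpow (by positivity) hkω (show 0 < 1 / r by positivity)
      rwa [← Real.rpow_mul hω, mul_one_div_cancel hr.ne', Real.rpow_one] at this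
    have h2 : ((k : ℝ) ^ (1 / r)) ^ r = k := by
      rw [← Real.rpow_mul (by positivity), one_div_mul_cancel hr.ne', Real.rpow_one]
    rw [h2] at hk
    calc Real.exp (β * (k + 1)) * P.real {ω | (k : ℝ) < X ω ^ r}
        ≤ Real.exp (β * (k + 1)) * (C * Real.exp (-α * k)) := by gcongr; exact h1.trans hk
      _ = (C * Real.exp β) * Real.exp (-(α - β)) ^ k := by
        rw [← Real.exp_nat_mul, mul_left_comm, mul_assoc, ← Real.exp_add, ← Real.exp_add]
        ring_nf
  exact hsum.tsum_ofReal_lt_top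

lemma exists_sq_le_mul_exp {c r : ℝ} (hc : 0 < c) (hr : 0 < r) :
    ∃ C : ℝ, 1 ≤ C ∧ ∀ y : ℝ, 0 ≤ y → y ^ 2 ≤ C * Real.exp (c * y ^ r) := by
  set m := ⌈2 / r⌉₊
  have hm : 2 ≤ r * m := by
    have := Nat.le_ceil (2 / r)
    rwa [div_le_iff₀' hr] at this
  refine ⟨max 1 (m.factorial / c ^ m), le_max_left _ _, fun y hy => ?_⟩
  rcases le_total y 1 with h | h
  · calc y ^ 2 ≤ 1 * 1 := by nlinarith
      _ ≤ _ := by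
        gcongr
        · exact le_max_left _ _
        · exact Real.one_le_exp (by positivity)
  · have h1 := Real.pow_div_factorial_le_exp (x := c * y ^ r) (by positivity) m
    have h2 : y ^ 2 ≤ (y ^ r) ^ m := by
      rw [← Real.rpow_natCast (y ^ r), ← Real.rpow_mul hy, ← Real.rpow_two]
      exact Real.rpow_le_rpow_of_exponent_le h hm
    rw [mul_pow, div_le_iff₀ (by positivity)] at h1
    calc y ^ 2 ≤ (y ^ r) ^ m := h2
      _ ≤ m.factorial / c ^ m * Real.exp (c * y ^ r) := by
        rw [div_mul_eq_mul_div, le_div_iff₀ (by positivity)]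
        linarith
      _ ≤ _ := by gcongr; exact le_max_right _ _

lemma integrable_sq_of_integrable_exp {X : Ω → ℝ} (hX : Measurable X)
    (h0 : ∀ᵐ ω ∂P, 0 ≤ X ω) {β r : ℝ} (hβ : 0 < β) (hr : 0 < r)
    (hint : Integrable (fun ω => Real.exp (β * X ω ^ r)) P) :
    Integrable (fun ω => X ω ^ 2) P := by
  obtain ⟨C, -, hC⟩ := exists_sq_le_mul_exp hβ hr
  refine (hint.const_mul C).mono' (by fun_prop) ?_
  filter_upwards [h0] with ω hω
  rw [Real.norm_of_nonneg (by positivity)]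
  exact hC _ hω

lemma integrable_of_integrable_sq [IsFiniteMeasure P] {X : Ω → ℝ} (hX : Measurable X)
    (hint : Integrable (fun ω => X ω ^ 2) P) : Integrable X P :=
  ((memLp_two_iff_integrable_sq hX.aestronglyMeasurable).2 hint).integrable one_le_two

lemma exp_le_one_add_add_sq_mul_exp {u : ℝ} (hu : 0 ≤ u) :
    Real.exp u ≤ 1 + u + u ^ 2 * Real.exp u := by
  have h := Real.add_one_le_exp (-u)
  have h1 : Real.exp (-u) * Real.exp u = 1 := by rw [← Real.exp_add]; simp
  nlinarith [Real.exp_pos u, mul_le_mul_of_nonneg_left h (by linarith : 0 ≤ 1 + u),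
    mul_le_mul_of_nonneg_right (mul_le_mul_of_nonneg_left h (by linarith : 0 ≤ 1 + u))
      (Real.exp_pos u).le]

/-- The moment generating function, at `θ = λ M ^ (r - 1)`, of a variable truncated at `M`. The
point is that `θ z ≤ λ z ^ r` for `0 ≤ z ≤ M`, since `r ≤ 1`. -/
lemma mgf_min_le [IsProbabilityMeasure P] {Y : Ω → ℝ} (hY : Measurable Y)
    (h0 : ∀ᵐ ω ∂P, 0 ≤ Y ω) {β r a C C₀ l M : ℝ} (hr : 0 < r) (hr1 : r ≤ 1) (hβ : 0 < β)
    (hl : 0 < l) (hlβ : l ≤ β / 2)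
    (hC₀ : ∀ y : ℝ, 0 ≤ y → y ^ 2 ≤ C₀ * Real.exp (β / 2 * y ^ r)) (hM : 1 ≤ M)
    (hC₀1 : 1 ≤ C₀)
    (hmean : ∫ ω, Y ω ∂P ≤ a) (hint : Integrable (fun ω => Real.exp (β * Y ω ^ r)) P)
    (hexp : ∫ ω, Real.exp (β * Y ω ^ r) ∂P ≤ C) :
    mgf (fun ω => min (Y ω) M) P (l * M ^ (r - 1)) ≤
      Real.exp (l * M ^ (r - 1) * a + (l * M ^ (r - 1)) ^ 2 * (C₀ * C)) := by
  set θ := l * M ^ (r - 1)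
  have hM0 : 0 < M := by linarith
  have hθ : 0 < θ := by positivity
  have hYint : Integrable Y P :=
    integrable_of_integrable_sq hY (integrable_sq_of_integrable_exp hY h0 hβ hr hint)
  have hpt : ∀ᵐ ω ∂P, Real.exp (θ * min (Y ω) M) ≤
      1 + θ * Y ω + θ ^ 2 * (C₀ * Real.exp (β * Y ω ^ r)) := by
    filter_upwards [h0] with ω hω
    set z := min (Y ω) M
    have hz : 0 ≤ z := le_min hω hM0.le
    have hzY : z ≤ Y ω := min_le_left _ _
    have h1 : θ * z ≤ l * Y ω ^ r := by
      have h2 : M ^ (r - 1) * z ≤ z ^ r := by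
        rcases hz.eq_or_lt with h | h
        · rw [← h]; simp [Real.zero_rpow hr.ne']
        · calc M ^ (r - 1) * z ≤ z ^ (r - 1) * z := by
                gcongr ?_ * z
                exact Real.rpow_le_rpow_of_nonpos h (min_le_right _ _) (by linarith)
            _ = z ^ r := by rw [← Real.rpow_add_one h.ne', sub_add_cancel]
      have h3 : z ^ r ≤ Y ω ^ r := Real.rpow_le_rpow hz hzY hr.le
      calc θ * z = l * (M ^ (r - 1) * z) := by ring
        _ ≤ l * Y ω ^ r := by gcongr; exact h2.trans h3
    have h4 : Real.exp (θ * z) ≤ Real.exp (β / 2 * Y ω ^ r) := by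
      refine Real.exp_le_exp.2 (h1.trans ?_)
      have := Real.rpow_nonneg hω r
      gcongr
    have h5 : z ^ 2 ≤ C₀ * Real.exp (β / 2 * Y ω ^ r) :=
      le_trans (by gcongr) (hC₀ _ hω)
    have h6 : Real.exp (β / 2 * Y ω ^ r) * Real.exp (β / 2 * Y ω ^ r) =
        Real.exp (β * Y ω ^ r) := by rw [← Real.exp_add]; ring_nf
    calc Real.exp (θ * z) ≤ 1 + θ * z + (θ * z) ^ 2 * Real.exp (θ * z) :=
          exp_le_one_add_add_sq_mul_exp (by positivity)
      _ = 1 + θ * z + θ ^ 2 * (z ^ 2 * Real.exp (θ * z)) := by ring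
      _ ≤ 1 + θ * Y ω + θ ^ 2 *
          ((C₀ * Real.exp (β / 2 * Y ω ^ r)) * Real.exp (β / 2 * Y ω ^ r)) := by
        gcongr
      _ = _ := by rw [mul_assoc C₀, h6]
  have hint1 : Integrable (fun ω => 1 + θ * Y ω) P := (integrable_const _).add (hYint.const_mul θ)
  have hint2 : Integrable (fun ω => θ ^ 2 * (C₀ * Real.exp (β * Y ω ^ r))) P :=
    (hint.const_mul _).const_mul _
  calc mgf (fun ω => min (Y ω) M) P θ
      ≤ ∫ ω, (1 + θ * Y ω + θ ^ 2 * (C₀ * Real.exp (β * Y ω ^ r))) ∂P :=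
        integral_mono_of_nonneg (ae_of_all _ fun ω => (Real.exp_pos _).le) (hint1.add hint2) hpt
    _ = 1 + θ * ∫ ω, Y ω ∂P + θ ^ 2 * (C₀ * ∫ ω, Real.exp (β * Y ω ^ r) ∂P) := by
        rw [integral_add hint1 hint2, integral_add (integrable_const _) (hYint.const_mul θ)]
        simp only [integral_const_mul, integral_const, probReal_univ, one_smul]
    _ ≤ 1 + θ * a + θ ^ 2 * (C₀ * C) := by gcongr
    _ ≤ Real.exp (θ * a + θ ^ 2 * (C₀ * C)) := by
        linarith [Real.add_one_le_exp (θ * a + θ ^ 2 * (C₀ * C))]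

/-- A sum of `M` independent non-negative variables with means at most `a` and bounded moments
`E exp (β Y ^ r)` exceeds `M (a + δ)` with probability at most `(1 + C M) exp (-c M ^ r)`. -/
lemma exists_upper_tail_sum {β r C δ : ℝ} (hr : 0 < r) (hr1 : r ≤ 1) (hβ : 0 < β) (hC : 0 ≤ C)
    (hδ : 0 < δ) : ∃ c : ℝ, 0 < c ∧ ∀ {Ω : Type} [MeasurableSpace Ω] (P : Measure Ω)
      [IsProbabilityMeasure P] (Y : ℕ → Ω → ℝ) (M : ℕ) (a : ℝ), 1 ≤ M → iIndepFun Y P →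
      (∀ k, Measurable (Y k)) → (∀ k, ∀ᵐ ω ∂P, 0 ≤ Y k ω) → (∀ k, ∫ ω, Y k ω ∂P ≤ a) →
      (∀ k, Integrable (fun ω => Real.exp (β * Y k ω ^ r)) P) →
      (∀ k, ∫ ω, Real.exp (β * Y k ω ^ r) ∂P ≤ C) →
      P.real {ω | M * (a + δ) < ∑ k ∈ Finset.range M, Y k ω} ≤
        (1 + C * M) * Real.exp (-c * (M : ℝ) ^ r) := by
  obtain ⟨C₀, hC₀1, hC₀⟩ := exists_sq_le_mul_exp (half_pos hβ) hr
  set l := min (β / 2) (δ / (2 * (C₀ * C + 1))) with hl_def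
  have hl : 0 < l := lt_min (by positivity) (by positivity)
  have hlδ : l * (C₀ * C) ≤ δ / 2 := by
    have h1 : l ≤ δ / (2 * (C₀ * C + 1)) := min_le_right _ _
    rw [le_div_iff₀ (by positivity)] at h1
    nlinarith
  refine ⟨min (l * δ / 2) β, lt_min (by positivity) hβ, ?_⟩
  intro Ω _ P _ Y M a hM hind hmeas h0 hmean hint hexp
  have hM1 : (1 : ℝ) ≤ M := by exact_mod_cast hM
  have hM0 : (0 : ℝ) < M := by linarith
  set θ := l * (M : ℝ) ^ (r - 1) with hθ_def
  have hθ : 0 < θ := by positivity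
  have hθl : θ ≤ l := by
    have := Real.rpow_le_one_of_one_le_of_nonpos hM1 (by linarith : r - 1 ≤ 0)
    calc θ ≤ l * 1 := by rw [hθ_def]; gcongr
      _ = l := mul_one l
  have hMθ : M * θ = l * (M : ℝ) ^ r := by
    have : (M : ℝ) ^ (r - 1) * M = (M : ℝ) ^ r := by
      rw [← Real.rpow_add_one hM0.ne', sub_add_cancel]
    rw [hθ_def, ← this]; ring
  set Z : ℕ → Ω → ℝ := fun k ω => min (Y k ω) M
  have hZmeas (k : ℕ) : Measurable (Z k) := (hmeas k).min measurable_const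
  have hZind : iIndepFun Z P :=
    hind.comp (fun _ y => min y (M : ℝ)) fun _ => measurable_id.min measurable_const
  have hZint (k : ℕ) : Integrable (fun ω => Real.exp (θ * Z k ω)) P := by
    refine Integrable.of_bound (C := Real.exp (θ * M)) (by fun_prop) (ae_of_all _ fun ω => ?_)
    rw [Real.norm_of_nonneg (Real.exp_pos _).le]
    have : Z k ω ≤ M := min_le_right _ _
    gcongr
  -- the truncated variables: Chernoff's bound
  have hZ : P.real {ω | M * (a + δ) ≤ (∑ k ∈ Finset.range M, Z k) ω} ≤
      Real.exp (-(l * δ / 2) * (M : ℝ) ^ r) := by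
    calc P.real {ω | M * (a + δ) ≤ (∑ k ∈ Finset.range M, Z k) ω}
        ≤ Real.exp (-θ * (M * (a + δ))) * mgf (∑ k ∈ Finset.range M, Z k) P θ :=
          measure_ge_le_exp_mul_mgf _ hθ.le (hZind.integrable_exp_mul_sum hZmeas fun k _ => hZint k)
      _ ≤ Real.exp (-θ * (M * (a + δ))) *
          ∏ k ∈ Finset.range M, Real.exp (θ * a + θ ^ 2 * (C₀ * C)) := by
        rw [hZind.mgf_sum hZmeas]
        gcongr with k _
        · exact fun k _ => mgf_nonneg
        · exact mgf_min_le (hmeas k) (h0 k) hr hr1 hβ hl (min_le_left _ _) hC₀ hM1 hC₀1 (hmean k)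
            (hint k) (hexp k)
      _ = Real.exp (-(M * θ) * (δ - θ * (C₀ * C))) := by
        rw [Finset.prod_const, Finset.card_range, ← Real.exp_nat_mul, ← Real.exp_add]
        ring_nf
      _ ≤ Real.exp (-(l * δ / 2) * (M : ℝ) ^ r) := by
        rw [hMθ]
        refine Real.exp_le_exp.2 ?_
        have h1 : θ * (C₀ * C) ≤ l * (C₀ * C) := by gcongr
        have h2 : 0 ≤ l * (M : ℝ) ^ r := by positivity
        nlinarith
  -- the event that some variable exceeds the truncation level
  have hbig (k : ℕ) : P.real {ω | (M : ℝ) < Y k ω} ≤ C * Real.exp (-β * (M : ℝ) ^ r) := by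
    refine (measureReal_lt_le_exp_mul_integral hβ.le hr.le hM0.le (hint k)).trans ?_
    rw [mul_comm]
    gcongr
    exact hexp k
  have hsub : {ω | M * (a + δ) < ∑ k ∈ Finset.range M, Y k ω} ⊆
      {ω | M * (a + δ) ≤ (∑ k ∈ Finset.range M, Z k) ω} ∪
        ⋃ k ∈ Finset.range M, {ω | (M : ℝ) < Y k ω} := by
    intro ω hω
    by_cases h : ∃ k ∈ Finset.range M, (M : ℝ) < Y k ω
    · obtain ⟨k, hk, hk'⟩ := h
      exact Or.inr (Set.mem_biUnion hk hk')
    · push Not at h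
      refine Or.inl ?_
      simp only [Set.mem_ofPred_eq, Finset.sum_apply] at hω ⊢
      rw [Finset.sum_congr rfl fun k hk => min_eq_left (h k hk)]
      exact hω.le
  calc P.real {ω | M * (a + δ) < ∑ k ∈ Finset.range M, Y k ω}
      ≤ P.real {ω | M * (a + δ) ≤ (∑ k ∈ Finset.range M, Z k) ω} +
          ∑ k ∈ Finset.range M, P.real {ω | (M : ℝ) < Y k ω} :=
        (measureReal_mono hsub).trans ((measureReal_union_le _ _).trans
          (by gcongr; exact measureReal_biUnion_finset_le _ _))
    _ ≤ Real.exp (-(l * δ / 2) * (M : ℝ) ^ r) +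
          ∑ k ∈ Finset.range M, C * Real.exp (-β * (M : ℝ) ^ r) := by
        gcongr with k _
        exact hbig k
    _ ≤ Real.exp (-(min (l * δ / 2) β) * (M : ℝ) ^ r) +
          M * (C * Real.exp (-(min (l * δ / 2) β) * (M : ℝ) ^ r)) := by
        rw [Finset.sum_const, Finset.card_range, nsmul_eq_mul]
        gcongr
        · exact min_le_left _ _
        · exact min_le_right _ _
    _ = _ := by ring

lemma rpow_sum_le_sum_rpow {ι : Type*} {r : ℝ} (hr : 0 < r) (hr1 : r ≤ 1) (s : Finset ι)
    {f : ι → ℝ} (hf : ∀ i, 0 ≤ f i) : (∑ i ∈ s, f i) ^ r ≤ ∑ i ∈ s, f i ^ r := by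
  classical
  induction s using Finset.induction_on with
  | empty => simp [Real.zero_rpow hr.ne']
  | insert i s hi ih =>
    rw [Finset.sum_insert hi, Finset.sum_insert hi]
    exact (Real.rpow_add_le_add_rpow (hf i) (Finset.sum_nonneg fun j _ => hf j) hr.le hr1).trans
      (by gcongr)

end StretchedMoments

/-- The passage time of a self-avoiding walk has the same stretched exponential moments as a single
weight: this is where `r ≤ 1` is used, through `(a + b) ^ r ≤ a ^ r + b ^ r`. -/
lemma integrable_exp_walkTime (ν : Measure ℝ) [IsProbabilityMeasure ν]
    (hν : ∀ᵐ t ∂ν, 0 ≤ t) {β r : ℝ} (hr : 0 < r) (hr1 : r ≤ 1) (hβ : 0 ≤ β)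
    (hint : Integrable (fun t => Real.exp (β * t ^ r)) ν) {x y : Fin d → ℤ}
    {γ : (lattice d).Walk x y} (hγ : γ.IsPath) :
    Integrable (fun W => Real.exp (β * walkTime W γ ^ r)) (envLaw d ν) := by
  classical
  have hind : iIndepFun (fun (e : Sym2 (Fin d → ℤ)) (W : Env d) => W e ^ r) (envLaw d ν) :=
    iIndepFun_infinitePi (P := fun _ => ν) (X := fun _ t => t ^ r) fun _ => by fun_prop
  have hsum := hind.integrable_exp_mul_sum (t := β) (s := γ.edges.toFinset)
    (fun e => by fun_prop)
    fun e _ => ((measurePreserving_eval ν e).integrable_comp (by fun_prop)).2 hint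
  refine hsum.mono' (Measurable.aestronglyMeasurable (by fun_prop)) ?_
  filter_upwards [ae_nonneg ν hν] with W hW
  rw [Real.norm_of_nonneg (Real.exp_pos _).le]
  have h : walkTime W γ = ∑ e ∈ γ.edges.toFinset, W e :=
    (List.sum_toFinset _ hγ.isTrail.edges_nodup).symm
  rw [h, Finset.sum_apply]
  gcongr
  exact rpow_sum_le_sum_rpow hr hr1 _ hW

/-! ### Approximation by finitely many walks -/

lemma exists_tendsto_min_walkTime (u : Fin d → ℤ) :
    ∃ g : ℕ → (lattice d).Walk 0 u, (g 0).IsPath ∧ ∀ W : Env d, (∀ e, 0 ≤ W e) →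
      Tendsto (fun n => (Finset.range (n + 1)).inf' ⟨0, by simp⟩ fun i => walkTime W (g i))
        atTop (𝓝 (siteTime W 0 u)) := by
  classical
  obtain ⟨f, hf⟩ := exists_surjective_nat ((lattice d).Walk 0 u)
  refine ⟨fun n => Nat.casesOn n (f 0).bypass f, (f 0).bypass_isPath, fun W hW => ?_⟩
  refine tendsto_order.2 ⟨fun a ha => Eventually.of_forall fun n => ha.trans_le ?_, fun a ha => ?_⟩
  · exact Finset.le_inf' _ _ fun i _ => siteTime_le hW _
  · obtain ⟨γ, hγ⟩ := exists_lt_of_ciInf_lt ha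
    obtain ⟨i, rfl⟩ := hf γ
    filter_upwards [eventually_ge_atTop (i + 1)] with n hn
    exact (Finset.inf'_le _ (b := i + 1) (by simp; omega)).trans_lt hγ

section Local

variable (ν : Measure ℝ) [IsProbabilityMeasure ν]

lemma integrable_siteTime_of_walk (hν : ∀ᵐ t ∂ν, 0 ≤ t) {x y : Fin d → ℤ}
    {γ : (lattice d).Walk x y} (hγ : Integrable (fun W => walkTime W γ) (envLaw d ν)) :
    Integrable (fun W => siteTime W x y) (envLaw d ν) := by
  refine hγ.mono' (measurable_siteTime x y).aestronglyMeasurable ?_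
  filter_upwards [ae_nonneg ν hν] with W hW
  rw [Real.norm_of_nonneg (siteTime_nonneg hW _ _)]
  exact siteTime_le hW γ

/-- The passage time from `0` to `u` is dominated by a function of finitely many weights, the
minimum over a large finite set of walks, whose mean is larger by at most `1`. -/
lemma exists_local_bound (hν : ∀ᵐ t ∂ν, 0 ≤ t) {β r : ℝ} (hr : 0 < r) (hr1 : r ≤ 1) (hβ : 0 < β)
    (hint : Integrable (fun t => Real.exp (β * t ^ r)) ν) (u : Fin d → ℤ) :
    ∃ (X : Env d → ℝ) (S : Finset (Sym2 (Fin d → ℤ))), Measurable X ∧ DependsOn X S ∧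
      (∀ W : Env d, (∀ e, 0 ≤ W e) → siteTime W 0 u ≤ X W) ∧
      ∫ W, X W ∂(envLaw d ν) ≤ ∫ W, siteTime W 0 u ∂(envLaw d ν) + 1 ∧
      Integrable (fun W => Real.exp (β * X W ^ r)) (envLaw d ν) := by
  classical
  obtain ⟨g, hg0, hg⟩ := exists_tendsto_min_walkTime u
  set X : ℕ → Env d → ℝ := fun n W =>
    (Finset.range (n + 1)).inf' ⟨0, by simp⟩ fun i => walkTime W (g i)
  have hXm (n : ℕ) : Measurable (X n) := by
    have := Finset.inf'_induction (s := Finset.range (n + 1)) ⟨0, by simp⟩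
      (fun i (W : Env d) => walkTime W (g i)) (p := Measurable) (fun _ h _ h' => h.inf h')
      fun i _ => measurable_walkTime (g i)
    convert! this using 1
    ext W
    exact (Finset.inf'_apply (C := fun _ => ℝ) _ (fun i W => walkTime W (g i)) W).symm
  have hle (n : ℕ) (W : Env d) (hW : ∀ e, 0 ≤ W e) : siteTime W 0 u ≤ X n W :=
    Finset.le_inf' _ _ fun i _ => siteTime_le hW _
  have hle0 (n : ℕ) (W : Env d) : X n W ≤ walkTime W (g 0) := Finset.inf'_le _ (by simp)
  have hexp0 := integrable_exp_walkTime ν hν hr hr1 hβ.le hint hg0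
  have hw0 : ∀ᵐ W ∂(envLaw d ν), 0 ≤ walkTime W (g 0) := by
    filter_upwards [ae_nonneg ν hν] with W hW using walkTime_nonneg hW _
  have hint0 : Integrable (fun W => walkTime W (g 0)) (envLaw d ν) :=
    integrable_of_integrable_sq (measurable_walkTime _)
      (integrable_sq_of_integrable_exp (measurable_walkTime _) hw0 hβ hr hexp0)
  have hlim : Tendsto (fun n => ∫ W, X n W ∂(envLaw d ν)) atTop
      (𝓝 (∫ W, siteTime W 0 u ∂(envLaw d ν))) := by
    refine tendsto_integral_of_dominated_convergence (fun W => walkTime W (g 0))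
      (fun n => (hXm n).aestronglyMeasurable) hint0 (fun n => ?_) ?_
    · filter_upwards [ae_nonneg ν hν] with W hW
      rw [Real.norm_of_nonneg ((siteTime_nonneg hW 0 u).trans (hle n W hW))]
      exact hle0 n W
    · filter_upwards [ae_nonneg ν hν] with W hW using hg W hW
  obtain ⟨n, hn⟩ := (hlim.eventually_le_const (lt_add_one _)).exists
  refine ⟨X n, (Finset.range (n + 1)).biUnion fun i => (g i).edges.toFinset, hXm n, ?_, hle n, hn,
    ?_⟩
  · intro W W' h
    refine Finset.inf'_congr _ rfl fun i hi => dependsOn_walkTime (g i) fun e he => h e ?_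
    simp only [Finset.coe_biUnion, Set.mem_iUnion]
    exact ⟨i, hi, by simpa using he⟩
  · refine hexp0.mono' (Measurable.aestronglyMeasurable (by have := hXm n; fun_prop)) ?_
    filter_upwards [ae_nonneg ν hν] with W hW
    rw [Real.norm_of_nonneg (Real.exp_pos _).le]
    have := (siteTime_nonneg hW 0 u).trans (hle n W hW)
    gcongr
    exact hle0 n W

end Local

/-! ### Edge-disjoint walks -/

lemma exists_line {x y u : Fin d → ℤ} (hu : (lattice d).Adj 0 u) (n : ℕ)
    (hy : y = x + (n : ℤ) • u) :
    ∃ γ : (lattice d).Walk x y, ∀ e ∈ γ.edges, ∃ t : ℤ, 0 ≤ t ∧ t + 1 ≤ n ∧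
      e = s(x + t • u, x + (t + 1) • u) := by
  subst hy
  induction n with
  | zero => exact ⟨SimpleGraph.Walk.nil.copy rfl (by simp), by simp⟩
  | succ n ih =>
    obtain ⟨γ, hγ⟩ := ih
    have hadj : (lattice d).Adj (x + (n : ℤ) • u) (x + ((n + 1 : ℕ) : ℤ) • u) := by
      simp only [lattice, Pi.zero_apply, zero_sub, abs_neg, Pi.add_apply, Pi.smul_apply,
        smul_eq_mul] at hu ⊢
      rw [← hu]
      refine Finset.sum_congr rfl fun i _ => ?_
      rw [← abs_neg]
      congr 1
      push_cast
      ring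
    refine ⟨γ.concat hadj, fun e he => ?_⟩
    rw [SimpleGraph.Walk.edges_concat, List.concat_eq_append, List.mem_append,
      List.mem_singleton] at he
    rcases he with he | rfl
    · obtain ⟨t, h0, h1, rfl⟩ := hγ e he
      exact ⟨t, h0, by push_cast; omega, rfl⟩
    · exact ⟨n, by positivity, by push_cast; rfl, by push_cast; rfl⟩

lemma exists_walk_append {Q : Sym2 (Fin d → ℤ) → Prop} {x y z : Fin d → ℤ}
    (h : ∃ γ : (lattice d).Walk x y, ∀ e ∈ γ.edges, Q e)
    (h' : ∃ γ : (lattice d).Walk y z, ∀ e ∈ γ.edges, Q e) :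
    ∃ γ : (lattice d).Walk x z, ∀ e ∈ γ.edges, Q e := by
  obtain ⟨γ, hγ⟩ := h
  obtain ⟨γ', hγ'⟩ := h'
  refine ⟨γ.append γ', fun e he => ?_⟩
  rw [SimpleGraph.Walk.edges_append, List.mem_append] at he
  exact he.elim (hγ e) (hγ' e)

lemma exists_line_of_forall {Q : Sym2 (Fin d → ℤ) → Prop} {x y : Fin d → ℤ} (i : Fin d) {s : ℤ}
    (hs : s = 1 ∨ s = -1) (n : ℕ) (hy : y = x + Pi.single i (n * s))
    (hQ : ∀ t : ℤ, 0 ≤ t → t + 1 ≤ n →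
      Q s(x + Pi.single i (t * s), x + Pi.single i ((t + 1) * s))) :
    ∃ γ : (lattice d).Walk x y, ∀ e ∈ γ.edges, Q e := by
  have hadj : (lattice d).Adj 0 (Pi.single i s) := by
    simp only [lattice, Pi.zero_apply, zero_sub, abs_neg]
    rw [Finset.sum_eq_single_of_mem i (Finset.mem_univ i)
      fun j _ hj => by simp [Pi.single_eq_of_ne hj]]
    rcases hs with rfl | rfl <;> simp
  have hsm (t : ℤ) : t • (Pi.single i s : Fin d → ℤ) = Pi.single i (t * s) := by
    rw [← Pi.single_smul, smul_eq_mul]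
  obtain ⟨γ, hγ⟩ := exists_line hadj n (y := y) (x := x) (by rw [hy, hsm])
  refine ⟨γ, fun e he => ?_⟩
  obtain ⟨t, h0, h1, rfl⟩ := hγ e he
  rw [hsm, hsm]
  exact hQ t h0 h1

/-- A property of edges that is satisfied by all edges of the walk number `(j, σ)` in a family of
`2d` edge-disjoint walks from `0` to `L e_b`. For `j ≠ b` the walk runs parallel to the segment
from `0` to `L e_b`, displaced by `± e_j`; the walk number `(b, true)` is the segment itself, and
the walk number `(b, false)` leaves `0` backwards and makes a detour at distance `2` in
direction `e_a`. -/
def IsLaneEdge (a b : Fin d) (L : ℤ) (p : Fin d × Bool) (e : Sym2 (Fin d → ℤ)) : Prop :=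
  if p.1 = b then
    if p.2 then ∀ y ∈ e, 0 ≤ y b ∧ y b ≤ L ∧ ∀ i, i ≠ b → y i = 0
    else ∃ y ∈ e, y b < 0 ∨ L < y b ∨ y a = 2
  else (∃ y ∈ e, y p.1 = if p.2 then 1 else -1) ∧
    ∀ y ∈ e, 0 ≤ y b ∧ y b ≤ L ∧ (y p.1 = 0 ∨ y p.1 = if p.2 then 1 else -1) ∧
      ∀ i, i ≠ b → i ≠ p.1 → y i = 0

lemma IsLaneEdge.eq {a b : Fin d} (hab : a ≠ b) {L : ℤ} {p q : Fin d × Bool}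
    {e : Sym2 (Fin d → ℤ)} (hp : IsLaneEdge a b L p e) (hq : IsLaneEdge a b L q e) : p = q := by
  -- an edge of the detour has an endpoint outside the region that contains all other walks
  have key {q : Fin d × Bool} (h : IsLaneEdge a b L (b, false) e) (hq : IsLaneEdge a b L q e) :
      q = (b, false) := by
    by_contra hne
    simp only [IsLaneEdge, if_true, Bool.false_eq_true, if_false] at h
    obtain ⟨y, hy, h⟩ := h
    obtain ⟨j, σ⟩ := q
    by_cases hj : j = b
    · subst hj
      have hσ : σ = true := by simpa using hne
      subst hσ
      simp only [IsLaneEdge, if_true] at hq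
      obtain ⟨h1, h2, h3⟩ := hq y hy
      have := h3 a hab
      omega
    · simp only [IsLaneEdge, hj, if_false] at hq
      obtain ⟨h1, h2, h3, h4⟩ := hq.2 y hy
      by_cases haj : a = j
      · subst haj
        cases σ <;> simp at h3 <;> omega
      · have := h4 a hab haj
        omega
  by_cases hp' : p = (b, false)
  · subst hp'; exact (key hp hq).symm
  by_cases hq' : q = (b, false)
  · subst hq'; exact key hq hp
  obtain ⟨j, σ⟩ := p
  obtain ⟨k, σ'⟩ := q
  by_cases hj : j = b <;> by_cases hk : k = b
  · subst hj hk
    have h1 : σ = true := by simpa using hp'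
    have h2 : σ' = true := by simpa using hq'
    rw [h1, h2]
  · subst hj
    have h1 : σ = true := by simpa using hp'
    subst h1
    simp only [IsLaneEdge, hk, if_true, if_false] at hp hq
    obtain ⟨y, hy, h⟩ := hq.1
    have := (hp y hy).2.2 k hk
    cases σ' <;> simp at h <;> omega
  · subst hk
    have h1 : σ' = true := by simpa using hq'
    subst h1
    simp only [IsLaneEdge, hj, if_true, if_false] at hp hq
    obtain ⟨y, hy, h⟩ := hp.1
    have := (hq y hy).2.2 j hj
    cases σ <;> simp at h <;> omega
  · simp only [IsLaneEdge, hj, hk, if_false] at hp hq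
    obtain ⟨y, hy, h⟩ := hp.1
    obtain ⟨h1, h2, h3, h4⟩ := hq.2 y hy
    by_cases hjk : j = k
    · subst hjk
      cases σ <;> cases σ' <;> simp_all
    · have := h4 j hj hjk
      cases σ <;> simp at h <;> omega

lemma exists_walk_isLaneEdge {a b : Fin d} (hab : a ≠ b) (L : ℕ) (p : Fin d × Bool) :
    ∃ γ : (lattice d).Walk 0 (Pi.single b (L : ℤ)),
      ∀ e ∈ γ.edges, IsLaneEdge a b L p e := by
  have hba := hab.symm
  obtain ⟨j, σ⟩ := p
  by_cases hj : j = b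
  · subst hj
    cases σ
    · -- the detour
      refine exists_walk_append (y := Pi.single j (-1)) ?_ <|
        exists_walk_append (y := Pi.single j (-1) + Pi.single a 2) ?_ <|
        exists_walk_append (y := Pi.single j (L + 1 : ℤ) + Pi.single a 2) ?_ <|
        exists_walk_append (y := Pi.single j (L + 1 : ℤ)) ?_ ?_
      · refine exists_line_of_forall j (s := -1) (by simp) 1 (by simp) fun t h0 h1 => ?_
        simp only [IsLaneEdge, if_true, Bool.false_eq_true, if_false]
        refine ⟨_, Sym2.mem_mk_right _ _, ?_⟩
        simp
        omega
      · refine exists_line_of_forall a (s := 1) (by simp) 2 (by simp) fun t h0 h1 => ?_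
        simp only [IsLaneEdge, if_true, Bool.false_eq_true, if_false]
        refine ⟨_, Sym2.mem_mk_left _ _, ?_⟩
        simp [hba]
      · refine exists_line_of_forall j (s := 1) (by simp) (L + 2) ?_ fun t h0 h1 => ?_
        · rw [add_right_comm, ← Pi.single_add]
          push_cast
          ring_nf
        simp only [IsLaneEdge, if_true, Bool.false_eq_true, if_false]
        refine ⟨_, Sym2.mem_mk_left _ _, ?_⟩
        simp [hab]
      · refine exists_line_of_forall a (s := -1) (by simp) 2 ?_ fun t h0 h1 => ?_
        · rw [add_assoc, ← Pi.single_add]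
          simp
        simp only [IsLaneEdge, if_true, Bool.false_eq_true, if_false]
        refine ⟨_, Sym2.mem_mk_left _ _, ?_⟩
        simp [hba]
      · refine exists_line_of_forall j (s := -1) (by simp) 1 ?_ fun t h0 h1 => ?_
        · rw [← Pi.single_add]
          simp
        simp only [IsLaneEdge, if_true, Bool.false_eq_true, if_false]
        refine ⟨_, Sym2.mem_mk_left _ _, ?_⟩
        simp
        omega
    · refine exists_line_of_forall j (s := 1) (by simp) L (by simp) fun t h0 h1 => ?_
      simp only [IsLaneEdge, if_true, Sym2.mem_iff]
      rintro y (rfl | rfl) <;> simp +contextual <;> omega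
  · set s : ℤ := if σ then 1 else -1 with hs
    have hs1 : s = 1 ∨ s = -1 := by cases σ <;> simp [hs]
    have hbj : b ≠ j := Ne.symm hj
    refine exists_walk_append (y := Pi.single j s) ?_ <|
      exists_walk_append (y := Pi.single j s + Pi.single b (L : ℤ)) ?_ ?_
    · refine exists_line_of_forall j (s := s) hs1 1 (by simp) fun t h0 h1 => ?_
      obtain rfl : t = 0 := by push_cast at h1; omega
      simp only [IsLaneEdge, hj, if_false, Sym2.mem_iff]
      refine ⟨⟨_, Or.inr rfl, by simp [hs]⟩, ?_⟩
      rintro y (rfl | rfl) <;> simp +contextual [hbj, hs]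
    · refine exists_line_of_forall b (s := 1) (by simp) L (by simp) fun t h0 h1 => ?_
      simp only [IsLaneEdge, hj, if_false, Sym2.mem_iff]
      refine ⟨⟨_, Or.inr rfl, by simp [hs, hj]⟩, ?_⟩
      rintro y (rfl | rfl) <;> simp +contextual [hbj, hj, hs] <;> omega
    · refine exists_line_of_forall j (s := -s) (by omega) 1 ?_ fun t h0 h1 => ?_
      · rw [add_right_comm, ← Pi.single_add]
        simp
      obtain rfl : t = 0 := by push_cast at h1; omega
      simp only [IsLaneEdge, hj, if_false, Sym2.mem_iff]
      refine ⟨⟨_, Or.inl rfl, by simp [hs, hj]⟩, ?_⟩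
      rintro y (rfl | rfl) <;> simp +contextual [hbj, hj, hs]

/-- There are `2d` edge-disjoint paths from `0` to `L e_b`, one through each neighbour of `0`. -/
lemma exists_disjoint_paths {a b : Fin d} (hab : a ≠ b) (L : ℕ) :
    ∃ γ : Fin d × Bool → (lattice d).Walk 0 (Pi.single b (L : ℤ)), (∀ p, (γ p).IsPath) ∧
      Pairwise fun p q => Disjoint {e | e ∈ (γ p).edges} {e | e ∈ (γ q).edges} := by
  classical
  choose γ hγ using exists_walk_isLaneEdge hab L
  refine ⟨fun p => (γ p).bypass, fun p => (γ p).bypass_isPath, fun p q hpq => ?_⟩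
  refine Set.disjoint_left.2 fun e hp hq => hpq ?_
  exact (hγ p e ((γ p).edges_bypass_subset_edges hp)).eq hab
    (hγ q e ((γ q).edges_bypass_subset_edges hq))

/-! ### Leaving a site -/

section Hub

variable (ν : Measure ℝ) [IsProbabilityMeasure ν]

/-- The passage time from `0` to a fixed site `L e_b` is dominated by the minimum over `2d`
edge-disjoint paths, so its tail is of order at most `exp (-2dβ s ^ r)` for each `β < α`. -/
lemma exists_hub_single (hν : ∀ᵐ t ∂ν, 0 ≤ t) {α β r : ℝ} (hr : 0 < r) (hr1 : r ≤ 1)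
    (hint : ∀ β, 0 ≤ β → β < α → Integrable (fun t => Real.exp (β * t ^ r)) ν)
    (hβ : 0 < β) (hβα : β < 2 * d * α) {a b : Fin d} (hab : a ≠ b) (L : ℕ) :
    ∃ (D : Env d → ℝ) (S : Finset (Sym2 (Fin d → ℤ))), Measurable D ∧ DependsOn D S ∧
      (∀ W : Env d, (∀ e, 0 ≤ W e) → siteTime W 0 (Pi.single b (L : ℤ)) ≤ D W) ∧
      Integrable (fun W => Real.exp (β * D W ^ r)) (envLaw d ν) := by
  classical
  have hd0 : (0 : ℝ) < 2 * d := by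
    have : 0 < d := Fin.pos a
    positivity
  obtain ⟨γ, hγ, hdisj⟩ := exists_disjoint_paths hab L
  obtain ⟨β₁, hβ₁, hβ₁α⟩ : ∃ β₁, β / (2 * d) < β₁ ∧ β₁ < α :=
    exists_between (by rwa [div_lt_iff₀' hd0])
  have hβ₁0 : 0 < β₁ := lt_trans (by positivity) hβ₁
  have hne : (Finset.univ : Finset (Fin d × Bool)).Nonempty := ⟨(a, true), by simp⟩
  set D : Env d → ℝ := fun W => Finset.univ.inf' hne fun p => walkTime W (γ p)
  have hDm : Measurable D := by
    have := Finset.inf'_induction hne (fun p (W : Env d) => walkTime W (γ p)) (p := Measurable)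
      (fun _ h _ h' => h.inf h') fun p _ => measurable_walkTime (γ p)
    convert! this using 1
    ext W
    exact (Finset.inf'_apply (C := fun _ => ℝ) _ (fun p W => walkTime W (γ p)) W).symm
  have hle (W : Env d) (hW : ∀ e, 0 ≤ W e) : siteTime W 0 (Pi.single b (L : ℤ)) ≤ D W :=
    Finset.le_inf' _ _ fun p _ => siteTime_le hW _
  have hind : iIndepFun (fun p (W : Env d) => walkTime W (γ p)) (envLaw d ν) :=
    iIndepFun_of_dependsOn ν (fun p => measurable_walkTime (γ p))
      (fun p => dependsOn_walkTime (γ p)) hdisj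
  have hexp (p) := integrable_exp_walkTime ν hν hr hr1 hβ₁0.le (hint β₁ hβ₁0.le hβ₁α) (hγ p)
  refine ⟨D, Finset.univ.biUnion fun p => (γ p).edges.toFinset, hDm, ?_, hle, ?_⟩
  · intro W W' h
    refine Finset.inf'_congr _ rfl fun p _ => dependsOn_walkTime (γ p) fun e he => h e ?_
    simp only [Finset.coe_biUnion, Set.mem_iUnion]
    exact ⟨p, by simp, by simpa using he⟩
  · refine integrable_exp_of_tail hDm ?_ hr hβ.le (α := 2 * d * β₁)
      (C := ∏ p, ∫ W, Real.exp (β₁ * walkTime W (γ p) ^ r) ∂(envLaw d ν))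
      (by rwa [div_lt_iff₀' hd0] at hβ₁) ?_
    · filter_upwards [ae_nonneg ν hν] with W hW
      exact (siteTime_nonneg hW _ _).trans (hle W hW)
    filter_upwards [eventually_ge_atTop 0] with s hs
    have hset : {W | s < D W} = ⋂ p, {W | s < walkTime W (γ p)} := by
      ext W
      simp [D, Finset.lt_inf'_iff]
    have hprod := hind.meas_iInter (s := fun p => {W | s < walkTime W (γ p)})
      fun p => ⟨Set.Ioi s, measurableSet_Ioi, rfl⟩
    rw [hset, measureReal_def, hprod, ENNReal.toReal_prod]
    calc ∏ p, ((envLaw d ν) {W | s < walkTime W (γ p)}).toReal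
        ≤ ∏ p, (Real.exp (-β₁ * s ^ r) *
            ∫ W, Real.exp (β₁ * walkTime W (γ p) ^ r) ∂(envLaw d ν)) := by
          refine Finset.prod_le_prod (fun _ _ => ENNReal.toReal_nonneg) fun p _ => ?_
          exact measureReal_lt_le_exp_mul_integral hβ₁0.le hr.le hs (hexp p)
      _ = _ := by
          rw [Finset.prod_mul_distrib, Finset.prod_const, ← Real.exp_nat_mul, mul_comm]
          congr 2
          simp only [Finset.card_univ, Fintype.card_prod, Fintype.card_fin, Fintype.card_bool]
          push_cast
          ring

/-- The passage times from `0` to finitely many sites `L e_b` are dominated simultaneously by one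
function `D` of finitely many weights, with `E exp (β D ^ r) < ∞` for each `β < 2dα`. -/
lemma exists_hub (hν : ∀ᵐ t ∂ν, 0 ≤ t) {α β r : ℝ} (hr : 0 < r) (hr1 : r ≤ 1)
    (hint : ∀ β, 0 ≤ β → β < α → Integrable (fun t => Real.exp (β * t ^ r)) ν)
    (hβ : 0 < β) (hβα : β < 2 * d * α) {a b : Fin d} (hab : a ≠ b) (s : Finset ℕ) :
    ∃ (D : Env d → ℝ) (S : Finset (Sym2 (Fin d → ℤ))), Measurable D ∧ DependsOn D S ∧
      (∀ W : Env d, 0 ≤ D W) ∧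
      (∀ W : Env d, (∀ e, 0 ≤ W e) → ∀ L ∈ s, siteTime W 0 (Pi.single b (L : ℤ)) ≤ D W) ∧
      Integrable (fun W => Real.exp (β * D W ^ r)) (envLaw d ν) := by
  classical
  induction s using Finset.induction_on with
  | empty =>
    refine ⟨fun _ => 0, ∅, measurable_const, fun _ _ _ => rfl, fun _ => le_rfl, by simp, ?_⟩
    exact integrable_const _
  | insert L s _ ih =>
    obtain ⟨D, S, hDm, hDS, hD0, hD, hDi⟩ := ih
    obtain ⟨D', S', hDm', hDS', hD', hDi'⟩ := exists_hub_single ν hν hr hr1 hint hβ hβα hab L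
    refine ⟨fun W => max (D W) (D' W), S ∪ S', hDm.max hDm', fun W W' h => ?_,
      fun W => (hD0 W).trans (le_max_left _ _), fun W hW L' hL' => ?_, ?_⟩
    · dsimp only
      rw [hDS fun e he => h e (by simp [Finset.mem_coe.1 he]),
        hDS' fun e he => h e (by simp [Finset.mem_coe.1 he])]
    · rcases Finset.mem_insert.1 hL' with rfl | hL'
      · exact (hD' W hW).trans (le_max_right _ _)
      · exact (hD W hW L' hL').trans (le_max_left _ _)
    · refine (hDi.add hDi').mono' (Measurable.aestronglyMeasurable (by fun_prop))
        (ae_of_all _ fun W => ?_)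
      rw [Real.norm_of_nonneg (Real.exp_pos _).le]
      simp only [Pi.add_apply]
      rcases max_choice (D W) (D' W) with h | h <;> rw [h]
      · linarith [Real.exp_pos (β * D' W ^ r)]
      · linarith [Real.exp_pos (β * D W ^ r)]

end Hub

/-! ### Moments of passage times and the time constant -/

section TimeConstant

variable (ν : Measure ℝ) [IsProbabilityMeasure ν]

lemma integrable_eval {f : ℝ → ℝ} (hf : Integrable f ν) (e : Sym2 (Fin d → ℤ)) :
    Integrable (fun W : Env d => f (W e)) (envLaw d ν) :=
  (measurePreserving_eval ν e).integrable_comp_of_integrable hf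

/-- The mean passage time between two sites. -/
noncomputable def meanTime (ν : Measure ℝ) (x y : Fin d → ℤ) : ℝ :=
  ∫ W, siteTime W x y ∂(envLaw d ν)

lemma walkTime_eq_sum_fin (W : Env d) {x y : Fin d → ℤ} (γ : (lattice d).Walk x y) :
    walkTime W γ = ∑ i : Fin γ.edges.length, W γ.edges[i] := by
  rw [walkTime, ← Fin.sum_univ_getElem]
  simp only [List.getElem_map, Fin.getElem_fin]
  exact Fintype.sum_equiv (finCongr (List.length_map ..)) _ _ fun i => rfl

lemma integrable_walkTime (hint : Integrable (fun t => t) ν) {x y : Fin d → ℤ}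
    (γ : (lattice d).Walk x y) : Integrable (fun W => walkTime W γ) (envLaw d ν) := by
  simp only [walkTime_eq_sum_fin]
  exact integrable_finsetSum _ fun i _ => integrable_eval ν hint _

lemma integral_eval {f : ℝ → ℝ} (hf : Measurable f) (e : Sym2 (Fin d → ℤ)) :
    ∫ W, f (W e) ∂(envLaw d ν) = ∫ t, f t ∂ν := by
  conv_rhs => rw [← (measurePreserving_eval ν e).map_eq]
  rw [integral_map (measurePreserving_eval ν e).measurable.aemeasurable hf.aestronglyMeasurable]

lemma integral_walkTime (hint : Integrable (fun t => t) ν) {x y : Fin d → ℤ}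
    (γ : (lattice d).Walk x y) :
    ∫ W, walkTime W γ ∂(envLaw d ν) = γ.length * ∫ t, t ∂ν := by
  simp only [walkTime_eq_sum_fin]
  rw [integral_finsetSum _ fun i _ => integrable_eval ν hint _]
  simp only [integral_eval ν measurable_id', Finset.sum_const, Finset.card_univ, Fintype.card_fin,
    SimpleGraph.Walk.length_edges, nsmul_eq_mul]

variable {ν}

lemma integrable_siteTime (hν : ∀ᵐ t ∂ν, 0 ≤ t) (hint : Integrable (fun t => t) ν)
    (x y : Fin d → ℤ) : Integrable (fun W => siteTime W x y) (envLaw d ν) :=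
  integrable_siteTime_of_walk ν hν (integrable_walkTime ν hint (Classical.arbitrary _))

lemma meanTime_nonneg (hν : ∀ᵐ t ∂ν, 0 ≤ t) (x y : Fin d → ℤ) : 0 ≤ meanTime ν x y := by
  refine integral_nonneg_of_ae ?_
  filter_upwards [ae_nonneg ν hν] with W hW using siteTime_nonneg hW x y

lemma meanTime_le (hν : ∀ᵐ t ∂ν, 0 ≤ t) (hint : Integrable (fun t => t) ν) (x y : Fin d → ℤ) :
    meanTime ν x y ≤ (∑ i, |(x i : ℝ) - y i|) * ∫ t, t ∂ν := by
  obtain ⟨γ, hγ⟩ := exists_walk_length_le x y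
  calc meanTime ν x y ≤ ∫ W, walkTime W γ ∂(envLaw d ν) := by
        refine integral_mono_ae (integrable_siteTime hν hint x y) (integrable_walkTime ν hint γ) ?_
        filter_upwards [ae_nonneg ν hν] with W hW using siteTime_le hW γ
    _ = γ.length * ∫ t, t ∂ν := integral_walkTime ν hint γ
    _ ≤ _ := by
        gcongr
        · exact integral_nonneg_of_ae hν
        · exact_mod_cast hγ

lemma meanTime_triangle (hν : ∀ᵐ t ∂ν, 0 ≤ t) (hint : Integrable (fun t => t) ν)
    (x y z : Fin d → ℤ) : meanTime ν x z ≤ meanTime ν x y + meanTime ν y z := by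
  have hxy := integrable_siteTime hν hint x y
  have hyz := integrable_siteTime hν hint y z
  unfold meanTime
  rw [← integral_add hxy hyz]
  refine integral_mono_ae (integrable_siteTime hν hint x z) (hxy.add hyz) ?_
  filter_upwards [ae_nonneg ν hν] with W hW using siteTime_triangle hW x y z

lemma integral_comp_shiftEnv {f : Env d → ℝ} (hf : Measurable f) (z : Fin d → ℤ) :
    ∫ W, f (shiftEnv z W) ∂(envLaw d ν) = ∫ W, f W ∂(envLaw d ν) := by
  conv_rhs => rw [← (measurePreserving_shiftEnv ν z).map_eq]
  rw [integral_map (measurable_shiftEnv z).aemeasurable hf.aestronglyMeasurable]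

lemma integrable_comp_shiftEnv {f : Env d → ℝ} (hf : Integrable f (envLaw d ν))
    (z : Fin d → ℤ) : Integrable (fun W => f (shiftEnv z W)) (envLaw d ν) :=
  (measurePreserving_shiftEnv ν z).integrable_comp_of_integrable hf

lemma measureReal_comp_shiftEnv {s : Set (Env d)} (hs : MeasurableSet s) (z : Fin d → ℤ) :
    (envLaw d ν).real {W | shiftEnv z W ∈ s} = (envLaw d ν).real s :=
  (measurePreserving_shiftEnv ν z).measureReal_preimage hs.nullMeasurableSet

lemma meanTime_add_right (x y z : Fin d → ℤ) :
    meanTime ν (x + z) (y + z) = meanTime ν x y := by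
  unfold meanTime
  rw [← integral_comp_shiftEnv (measurable_siteTime x y) z]
  simp only [siteTime_shiftEnv]

lemma abs_floor_sub_floor_le (a b : ℝ) : |((⌊a⌋ : ℤ) : ℝ) - (⌊b⌋ : ℤ)| ≤ |a - b| + 1 := by
  have h1 := Int.floor_le a
  have h2 := Int.lt_floor_add_one a
  have h3 := Int.floor_le b
  have h4 := Int.lt_floor_add_one b
  rw [abs_le]
  rcases abs_cases (a - b) with ⟨h, _⟩ | ⟨h, _⟩ <;> rw [h] <;> constructor <;> linarith

lemma abs_floor_add_floor_sub_floor_le (a b : ℝ) :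
    |((⌊a⌋ : ℤ) : ℝ) + (⌊b⌋ : ℤ) - (⌊a + b⌋ : ℤ)| ≤ 1 := by
  have h1 := Int.le_floor_add a b
  have h2 := Int.le_floor_add_floor a b
  have h1' : ((⌊a⌋ : ℤ) : ℝ) + (⌊b⌋ : ℤ) ≤ (⌊a + b⌋ : ℤ) := by exact_mod_cast h1
  have h2' : ((⌊a + b⌋ : ℤ) : ℝ) - 1 ≤ (⌊a⌋ : ℤ) + (⌊b⌋ : ℤ) := by exact_mod_cast h2
  rw [abs_le]
  constructor <;> linarith

/-- Up to rounding, the mean passage time of an increment along direction `x` is that of a segment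
starting at the origin. -/
lemma meanTime_increment_le (hν : ∀ᵐ t ∂ν, 0 ≤ t) (hint : Integrable (fun t => t) ν)
    (x : Fin d → ℝ) (s t : ℝ) :
    meanTime ν (floorPt (s • x)) (floorPt ((s + t) • x)) ≤
      meanTime ν 0 (floorPt (t • x)) + d * ∫ t, t ∂ν := by
  have h0 : 0 ≤ ∫ t, t ∂ν := integral_nonneg_of_ae hν
  refine (meanTime_triangle hν hint _ (floorPt (t • x) + floorPt (s • x)) _).trans ?_
  have h1 := meanTime_add_right (ν := ν) 0 (floorPt (t • x)) (floorPt (s • x))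
  rw [zero_add] at h1
  rw [h1]
  gcongr
  refine (meanTime_le hν hint _ _).trans ?_
  gcongr
  calc ∑ i, |((floorPt (t • x) + floorPt (s • x)) i : ℝ) - (floorPt ((s + t) • x) i : ℤ)|
      ≤ ∑ _i : Fin d, (1 : ℝ) := by
        refine Finset.sum_le_sum fun i _ => ?_
        have := abs_floor_add_floor_sub_floor_le (t * x i) (s * x i)
        simp only [floorPt, Pi.add_apply, Pi.smul_apply, smul_eq_mul]
        push_cast
        rwa [add_mul, add_comm (s * x i)]
    _ = d := by simp

/-- The time constant exists, by Fekete's lemma. -/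
lemma exists_tendsto_meanTime (hν : ∀ᵐ t ∂ν, 0 ≤ t) (hint : Integrable (fun t => t) ν)
    (x : Fin d → ℝ) :
    ∃ l : ℝ, Tendsto (fun t : ℝ => t⁻¹ * meanTime ν 0 (floorPt (t • x))) atTop (𝓝 l) := by
  set g : ℝ → ℝ := fun t => meanTime ν 0 (floorPt (t • x)) with hg
  set K : ℝ := d * ∫ t, t ∂ν with hK
  have h0 : 0 ≤ ∫ t, t ∂ν := integral_nonneg_of_ae hν
  have hK0 : 0 ≤ K := by positivity
  have hsub : Subadditive fun n : ℕ => g n + K := by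
    intro m n
    have h1 := meanTime_triangle hν hint 0 (floorPt ((m : ℝ) • x)) (floorPt (((m : ℝ) + n) • x))
    have h2 := meanTime_increment_le hν hint x m n
    simp only [hg]
    push_cast
    linarith
  have hlim := hsub.tendsto_lim ⟨0, by
    rintro _ ⟨n, rfl⟩
    have : 0 ≤ g n := meanTime_nonneg hν _ _
    positivity⟩
  refine ⟨hsub.lim, ?_⟩
  -- pass from integer to real times
  set B : ℝ := (∑ i, (|x i| + 1)) * ∫ t, t ∂ν with hB
  have hdiff (t : ℝ) (ht : 0 ≤ t) : |g t - g ⌊t⌋₊| ≤ B := by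
    have hle (s s' : ℝ) (hs : |s - s'| ≤ 1) : g s - g s' ≤ B := by
      have h1 := meanTime_triangle hν hint 0 (floorPt (s' • x)) (floorPt (s • x))
      have h2 := meanTime_le hν hint (floorPt (s' • x)) (floorPt (s • x))
      have h3 : (∑ i, |(floorPt (s' • x) i : ℝ) - (floorPt (s • x) i : ℤ)|) * ∫ t, t ∂ν ≤ B := by
        rw [hB]
        gcongr with i
        simp only [floorPt, Pi.smul_apply, smul_eq_mul]
        refine (abs_floor_sub_floor_le _ _).trans ?_
        rw [← sub_mul, abs_mul, abs_sub_comm]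
        nlinarith [abs_nonneg (x i)]
      simp only [hg]
      linarith
    have h1 := Nat.floor_le ht
    have h2 := Nat.lt_floor_add_one t
    rw [abs_le]
    have h3 := hle t ⌊t⌋₊ (by rw [abs_le]; constructor <;> linarith)
    have h4 := hle ⌊t⌋₊ t (by rw [abs_le]; constructor <;> linarith)
    constructor <;> linarith
  have h1 : Tendsto (fun t : ℝ => (⌊t⌋₊ / t) * ((g ⌊t⌋₊ + K) / ⌊t⌋₊)) atTop (𝓝 hsub.lim) := by
    have := (tendsto_nat_floor_div_atTop (R := ℝ)).mul
      (hlim.comp (tendsto_nat_floor_atTop (α := ℝ)))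
    rw [one_mul] at this
    exact this
  have h2 : Tendsto (fun t : ℝ => t⁻¹ * (g t - (g ⌊t⌋₊ + K))) atTop (𝓝 0) := by
    refine squeeze_zero_norm' (a := fun t : ℝ => t⁻¹ * (B + K)) ?_ ?_
    · filter_upwards [eventually_gt_atTop 0] with t ht
      rw [norm_mul, Real.norm_of_nonneg (by positivity), Real.norm_eq_abs]
      gcongr
      have := hdiff t ht.le
      rw [abs_le] at this ⊢
      constructor <;> linarith
    · simpa using tendsto_inv_atTop_zero.mul_const (B + K)
  have h3 := h1.add h2
  rw [add_zero] at h3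
  refine h3.congr' ?_
  filter_upwards [eventually_ge_atTop 1] with t ht
  have : (⌊t⌋₊ : ℝ) ≠ 0 := by
    have := Nat.floor_pos.2 ht
    positivity
  have : t ≠ 0 := by linarith
  field_simp
  ring

lemma integrable_sq_siteTime (hν : ∀ᵐ t ∂ν, 0 ≤ t) (hsq : Integrable (fun t => t ^ 2) ν)
    (x y : Fin d → ℤ) : Integrable (fun W => siteTime W x y ^ 2) (envLaw d ν) ∧
      ∫ W, siteTime W x y ^ 2 ∂(envLaw d ν) ≤
        (∑ i, |(x i : ℝ) - y i|) ^ 2 * ∫ t, t ^ 2 ∂ν := by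
  obtain ⟨γ, hγ⟩ := exists_walk_length_le x y
  have hlen : γ.edges.length = γ.length := γ.length_edges
  have hdom : Integrable (fun W : Env d => (γ.length : ℝ) *
      ∑ i : Fin γ.edges.length, W γ.edges[i] ^ 2) (envLaw d ν) :=
    (integrable_finsetSum _ fun i _ => integrable_eval ν hsq _).const_mul _
  have hle : ∀ᵐ W ∂(envLaw d ν), siteTime W x y ^ 2 ≤
      (γ.length : ℝ) * ∑ i : Fin γ.edges.length, W γ.edges[i] ^ 2 := by
    filter_upwards [ae_nonneg ν hν] with W hW
    calc siteTime W x y ^ 2 ≤ walkTime W γ ^ 2 := by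
          have := siteTime_nonneg hW x y
          gcongr
          exact siteTime_le hW γ
      _ ≤ _ := by
          rw [walkTime_eq_sum_fin]
          have := sq_sum_le_card_mul_sum_sq (s := (Finset.univ : Finset (Fin γ.edges.length)))
            (f := fun i => W γ.edges[i])
          simpa [hlen] using this
  have hint : Integrable (fun W => siteTime W x y ^ 2) (envLaw d ν) := by
    refine hdom.mono' ((measurable_siteTime x y).pow_const 2).aestronglyMeasurable ?_
    filter_upwards [hle] with W hW
    rwa [Real.norm_of_nonneg (by positivity)]
  refine ⟨hint, (integral_mono_ae hint hdom hle).trans ?_⟩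
  rw [integral_const_mul, integral_finsetSum _ fun i _ => integrable_eval ν hsq _]
  simp only [integral_eval ν (f := fun t => t ^ 2) (by fun_prop), Finset.sum_const,
    Finset.card_univ, Fintype.card_fin, hlen, nsmul_eq_mul]
  rw [← mul_assoc, sq]
  have : (0 : ℝ) ≤ ∫ t, t ^ 2 ∂ν := integral_nonneg fun t => by positivity
  have h2 : (γ.length : ℝ) ≤ ∑ i, |(x i : ℝ) - y i| := by exact_mod_cast hγ
  gcongr

end TimeConstant

/-! ### Tubes along the direction `x` -/

lemma sum_range_mul_eq (f : ℕ → ℝ) (J m : ℕ) :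
    ∑ k ∈ Finset.range (J * m), f k =
      ∑ j ∈ Finset.range J, ∑ i ∈ Finset.range m, f (J * i + j) := by
  induction m with
  | zero => simp
  | succ m ih =>
    rw [mul_add, mul_one, Finset.sum_range_add, ih, ← Finset.sum_add_distrib]
    exact Finset.sum_congr rfl fun j _ => (Finset.sum_range_succ _ _).symm

section Tubes

variable {ν : Measure ℝ} [IsProbabilityMeasure ν]

/-- The passage time from `0` to `⌊n x⌋` is dominated by a function of the weights within bounded
distance of the line through `x`, which exceeds `n (l + ε)` only with stretched exponentially small
probability. It is a sum of local passage times over consecutive steps of bounded length; these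
fall into `J` classes, each of which consists of independent variables. -/
lemma exists_tube (hν : ∀ᵐ t ∂ν, 0 ≤ t) {β r : ℝ} (hr : 0 < r) (hr1 : r ≤ 1) (hβ : 0 < β)
    (hint : Integrable (fun t => Real.exp (β * t ^ r)) ν) {x : Fin d → ℝ} {a : Fin d}
    (ha : x a ≠ 0) {l : ℝ}
    (hl : Tendsto (fun t : ℝ => t⁻¹ * meanTime ν 0 (floorPt (t • x))) atTop (𝓝 l))
    {ε : ℝ} (hε : 0 < ε) :
    ∃ R A c : ℝ, 0 < c ∧ 0 ≤ A ∧ ∀ᶠ n : ℕ in atTop,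
      ∃ (F : Env d → ℝ) (S : Set (Sym2 (Fin d → ℤ))), Measurable F ∧ DependsOn F S ∧
        (∀ e ∈ S, ∀ y ∈ e, ∃ t : ℝ, ∀ i, |(y i : ℝ) - t * x i| ≤ R) ∧
        (∀ W : Env d, (∀ e, 0 ≤ W e) → siteTime W 0 (floorPt ((n : ℝ) • x)) ≤ F W) ∧
        (envLaw d ν).real {W | n * (l + ε) < F W} ≤ A * n * Real.exp (-c * (n : ℝ) ^ r) := by
  classical
  have hsq : Integrable (fun t => t ^ 2) ν :=
    integrable_sq_of_integrable_exp measurable_id hν hβ hr hint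
  have hint1 : Integrable (fun t => t) ν := integrable_of_integrable_sq measurable_id hsq
  set K : ℝ := d * ∫ t, t ∂ν with hK
  -- the length `N` of the steps
  obtain ⟨N, hN1, hN⟩ : ∃ N : ℝ, 1 ≤ N ∧ ∀ s, N ≤ s →
      meanTime ν 0 (floorPt (s • x)) + K + 1 ≤ s * (l + ε / 2) := by
    have h1 := hl.eventually_le_const (show l < l + ε / 4 by linarith)
    obtain ⟨N, hN⟩ := eventually_atTop.1
      ((h1.and (eventually_ge_atTop ((K + 1) / (ε / 4)))).and (eventually_ge_atTop 1))
    refine ⟨max N 1, le_max_right _ _, fun s hs => ?_⟩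
    obtain ⟨⟨h2, h3⟩, h4⟩ := hN s ((le_max_left _ _).trans hs)
    have hs0 : 0 < s := by linarith
    rw [inv_mul_le_iff₀ hs0] at h2
    rw [div_le_iff₀ (by positivity)] at h3
    linarith
  have hN0 : 0 < N := by linarith
  choose X S hXm hXS hX hXmean hXexp using exists_local_bound (d := d) ν hν hr hr1 hβ hint
  -- the finitely many possible steps
  obtain ⟨Q, hQ⟩ : ∃ Q : ℤ, ∀ i, 2 * N * |x i| + 1 ≤ Q := by
    refine ⟨⌈∑ i, (2 * N * |x i| + 1)⌉, fun i => le_trans ?_ (Int.le_ceil _)⟩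
    exact Finset.single_le_sum (f := fun i => 2 * N * |x i| + 1)
      (fun i _ => by positivity) (Finset.mem_univ i)
  set U : Finset (Fin d → ℤ) := Fintype.piFinset fun _ => Finset.Icc (-Q) Q with hU
  obtain ⟨R, hR⟩ : ∃ R : ℝ, ∀ u ∈ U, ∀ e ∈ S u, ∀ y ∈ e, ∀ i, |(y i : ℝ)| ≤ R := by
    obtain ⟨R, hR⟩ := (U.biUnion fun u => (S u).biUnion fun e => e.toFinset.biUnion fun y =>
      Finset.univ.image fun i => |(y i : ℝ)|).exists_le
    refine ⟨R, fun u hu e he y hy i => hR _ ?_⟩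
    simp only [Finset.mem_biUnion, Finset.mem_image]
    exact ⟨u, hu, e, he, y, by simpa using hy, i, Finset.mem_univ i, rfl⟩
  obtain ⟨C, hC⟩ : ∃ C : ℝ, ∀ u ∈ U, ∫ W, Real.exp (β * X u W ^ r) ∂(envLaw d ν) ≤ C := by
    obtain ⟨C, hC⟩ := (U.image fun u => ∫ W, Real.exp (β * X u W ^ r) ∂(envLaw d ν)).exists_le
    exact ⟨C, fun u hu => hC _ (Finset.mem_image_of_mem _ hu)⟩
  have hax : 0 < |x a| := abs_pos.2 ha
  -- steps whose indices differ by at least `J` use disjoint sets of weights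
  obtain ⟨J, hJ⟩ := exists_nat_gt ((2 * (max R 0) + 2) / (N * |x a|))
  rw [div_lt_iff₀ (by positivity)] at hJ
  have hJ0 : 0 < J := by
    rcases Nat.eq_zero_or_pos J with h | h
    · rw [h] at hJ; push_cast at hJ; linarith [le_max_right R 0]
    · exact h
  have hJ1 : (1 : ℝ) ≤ J := by exact_mod_cast hJ0
  obtain ⟨c, hc, hchernoff⟩ := exists_upper_tail_sum (C := max C 0) hr hr1 hβ (le_max_right _ _)
    (show 0 < N * ε / 2 by positivity)
  refine ⟨max R 0 + 1, J * (1 + max C 0), c * (2 * J * N)⁻¹ ^ r, by positivity, by positivity, ?_⟩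
  filter_upwards [eventually_ge_atTop ⌈J * N⌉₊] with n hn
  have hnJN : J * N ≤ n := Nat.ceil_le.1 hn
  have hn0 : (0 : ℝ) < n := lt_of_lt_of_le (by positivity) hnJN
  set m := ⌊n / (J * N)⌋₊ with hm
  have hm1 : 1 ≤ m := Nat.one_le_floor_iff _ |>.2 (by rwa [le_div_iff₀ (by positivity), one_mul])
  have hm1' : (1 : ℝ) ≤ m := by exact_mod_cast hm1
  have hm0 : (0 : ℝ) < m := by linarith
  have hmle : m * (J * N) ≤ n := by
    rw [← le_div_iff₀ (by positivity)]
    exact Nat.floor_le (by positivity)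
  have hmlt : n < (m + 1) * (J * N) := by
    rw [← div_lt_iff₀ (by positivity)]
    exact Nat.lt_floor_add_one _
  set s : ℝ := n / (J * m) with hs
  have hJm : (0 : ℝ) < J * m := by positivity
  have hsn : J * m * s = n := by rw [hs]; field_simp
  have hNs : N ≤ s := by rw [hs, le_div_iff₀ hJm]; linarith
  have hs2N : s ≤ 2 * N := by
    rw [hs, div_le_iff₀ hJm]
    have : (m + 1) * (J * N) ≤ (m + m) * (J * N) := by gcongr
    linarith
  have hs0 : 0 < s := by linarith
  set p : ℕ → Fin d → ℤ := fun k => floorPt ((k * s) • x) with hp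
  set u : ℕ → Fin d → ℤ := fun k => p (k + 1) - p k with hu
  have hp0 : p 0 = 0 := by ext i; simp [hp, floorPt]
  have hpn : p (J * m) = floorPt ((n : ℝ) • x) := by
    simp only [hp]
    rw [← hsn]
    push_cast
    rfl
  have huU (k : ℕ) : u k ∈ U := by
    rw [hU, Fintype.mem_piFinset]
    intro i
    have h1 : |((u k i : ℤ) : ℝ)| ≤ Q := by
      simp only [hu, hp, floorPt, Pi.sub_apply, Pi.smul_apply, smul_eq_mul]
      push_cast
      refine (abs_floor_sub_floor_le _ _).trans (le_trans ?_ (hQ i))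
      have : (k + 1) * s * x i - k * s * x i = s * x i := by ring
      rw [this, abs_mul, abs_of_pos hs0]
      gcongr
    rw [Finset.mem_Icc, ← abs_le]
    exact_mod_cast h1
  set Y : ℕ → Env d → ℝ := fun k W => X (u k) (shiftEnv (p k) W) with hY
  have hYm (k : ℕ) : Measurable (Y k) := (hXm _).comp (measurable_shiftEnv _)
  have hYS (k : ℕ) : DependsOn (Y k) (shiftEdge (p k) '' S (u k)) :=
    dependsOn_comp_shiftEnv (hXS (u k)) (p k)
  have hloc (k : ℕ) : ∀ e ∈ shiftEdge (p k) '' S (u k), ∀ y ∈ e, ∀ i,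
      |(y i : ℝ) - k * s * x i| ≤ max R 0 + 1 := by
    rintro _ ⟨e, he, rfl⟩ y hy i
    rw [mem_shiftEdge] at hy
    have h1 := hR _ (huU k) e he _ hy i
    simp only [hp, floorPt, Pi.sub_apply, Pi.smul_apply, smul_eq_mul] at h1
    push_cast at h1
    have h2 := Int.floor_le (k * s * x i)
    have h3 := Int.lt_floor_add_one (k * s * x i)
    have h4 := le_max_left R 0
    rw [abs_le] at h1 ⊢
    constructor <;> linarith
  have hshift (k : ℕ) (W : Env d) : siteTime (shiftEnv (p k) W) 0 (u k) =
      siteTime W (p k) (p (k + 1)) := by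
    rw [siteTime_shiftEnv, zero_add, hu, sub_add_cancel]
  have hY0 (k : ℕ) (W : Env d) (hW : ∀ e, 0 ≤ W e) : siteTime W (p k) (p (k + 1)) ≤ Y k W := by
    rw [← hshift]
    exact hX (u k) _ fun e => hW _
  have hYmean (k : ℕ) : ∫ W, Y k W ∂(envLaw d ν) ≤ s * (l + ε / 2) := by
    have h1 : ∫ W, Y k W ∂(envLaw d ν) ≤ meanTime ν 0 (u k) + 1 :=
      (integral_comp_shiftEnv (hXm (u k)) (p k)).trans_le (hXmean (u k))
    have h2 : meanTime ν 0 (u k) = meanTime ν (p k) (p (k + 1)) := by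
      rw [← meanTime_add_right 0 (u k) (p k), zero_add, hu, sub_add_cancel]
    have h3 := meanTime_increment_le hν hint1 x (k * s) s
    have h4 : (k * s + s) = ((k + 1 : ℕ) : ℝ) * s := by push_cast; ring
    rw [h4] at h3
    have h5 := hN s hNs
    rw [h2] at h1
    simp only [hp] at h1
    linarith
  refine ⟨fun W => ∑ k ∈ Finset.range (J * m), Y k W, ⋃ k, shiftEdge (p k) '' S (u k),
    Finset.measurable_fun_sum _ fun k _ => hYm k, ?_, ?_, ?_, ?_⟩
  · exact fun W W' h => Finset.sum_congr rfl fun k _ =>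
      hYS k fun e he => h e (Set.mem_iUnion.2 ⟨k, he⟩)
  · intro e he y hy
    obtain ⟨k, hk⟩ := Set.mem_iUnion.1 he
    exact ⟨k * s, hloc k e hk y hy⟩
  · intro W hW
    have := siteTime_le_sum hW p (J * m)
    rw [hp0, hpn] at this
    exact this.trans (Finset.sum_le_sum fun k _ => hY0 k W hW)
  · have hclass (j : ℕ) : (envLaw d ν).real
        {W | m * (s * (l + ε)) < ∑ i ∈ Finset.range m, Y (J * i + j) W} ≤
          (1 + max C 0 * m) * Real.exp (-c * (m : ℝ) ^ r) := by
      have hdisj : Pairwise fun i i' : ℕ => Disjoint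
          (shiftEdge (p (J * i + j)) '' (S (u (J * i + j)) : Set (Sym2 (Fin d → ℤ))))
          (shiftEdge (p (J * i' + j)) '' (S (u (J * i' + j)) : Set (Sym2 (Fin d → ℤ)))) := by
        intro i i' hii
        refine Set.disjoint_left.2 fun e he he' => ?_
        obtain ⟨y, hy⟩ : ∃ y, y ∈ e := ⟨_, e.out_fst_mem⟩
        have h1 := hloc _ e he y hy a
        have h2 := hloc _ e he' y hy a
        have h3 : |((J * i + j : ℕ) * s * x a) - ((J * i' + j : ℕ) * s * x a)| ≤
            2 * max R 0 + 2 := by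
          rw [abs_le] at h1 h2 ⊢
          constructor <;> linarith
        have h4 : ((J * i + j : ℕ) * s * x a) - ((J * i' + j : ℕ) * s * x a) =
            J * (((i : ℤ) - i' : ℤ) : ℝ) * (s * x a) := by push_cast; ring
        rw [h4, abs_mul, abs_mul, abs_mul, abs_of_pos hs0, Nat.abs_cast] at h3
        have h5 : (1 : ℝ) ≤ |(((i : ℤ) - i' : ℤ) : ℝ)| := by
          have : (1 : ℤ) ≤ |(i : ℤ) - i'| := Int.one_le_abs (by omega)
          exact_mod_cast this
        have h6 : J * 1 * (N * |x a|) ≤ J * |(((i : ℤ) - i' : ℤ) : ℝ)| * (s * |x a|) := by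
          gcongr
        linarith
      have hind : iIndepFun (fun i => Y (J * i + j)) (envLaw d ν) :=
        iIndepFun_of_dependsOn ν (fun i => hYm _) (fun i => hYS _) hdisj
      refine le_trans (measureReal_mono fun W hW => ?_)
        (hchernoff (envLaw d ν) (fun i => Y (J * i + j)) m (s * (l + ε / 2)) hm1 hind
        (fun i => hYm _) (fun i => ?_) (fun i => hYmean _) (fun i => ?_) fun i => ?_)
      · simp only [Set.mem_ofPred_eq] at hW ⊢
        refine lt_of_le_of_lt ?_ hW
        gcongr
        have : N * ε / 2 ≤ s * ε / 2 := by gcongr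
        linarith
      · filter_upwards [ae_nonneg ν hν] with W hW
        exact (siteTime_nonneg hW _ _).trans (hY0 _ W hW)
      · exact integrable_comp_shiftEnv (hXexp _) _
      · refine le_trans (le_of_eq ?_) ((hC _ (huU (J * i + j))).trans (le_max_left _ _))
        exact integral_comp_shiftEnv (f := fun W => Real.exp (β * X (u (J * i + j)) W ^ r))
          (by have := hXm (u (J * i + j)); fun_prop) (p (J * i + j))
    have hsub : {W : Env d | n * (l + ε) < ∑ k ∈ Finset.range (J * m), Y k W} ⊆
        ⋃ j ∈ Finset.range J, {W | m * (s * (l + ε)) < ∑ i ∈ Finset.range m, Y (J * i + j) W} := by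
      intro W hW
      simp only [Set.mem_ofPred_eq] at hW
      rw [sum_range_mul_eq (fun k => Y k W)] at hW
      by_contra hcon
      simp only [Set.mem_iUnion, Set.mem_ofPred_eq, not_exists, not_lt] at hcon
      have := Finset.sum_le_sum hcon
      rw [Finset.sum_const, Finset.card_range, nsmul_eq_mul] at this
      have h1 : (J : ℝ) * (m * (s * (l + ε))) = n * (l + ε) := by rw [← hsn]; ring
      linarith
    have hmn : (m : ℝ) ≤ n := by
      have : m * 1 ≤ m * (J * N) := by
        gcongr
        nlinarith
      linarith
    have hnm : (2 * J * N)⁻¹ * n ≤ m := by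
      rw [inv_mul_le_iff₀ (by positivity)]
      have : (m + 1) * (J * N) ≤ (m + m) * (J * N) := by gcongr
      linarith
    calc (envLaw d ν).real {W | n * (l + ε) < ∑ k ∈ Finset.range (J * m), Y k W}
        ≤ ∑ j ∈ Finset.range J, (envLaw d ν).real
            {W | m * (s * (l + ε)) < ∑ i ∈ Finset.range m, Y (J * i + j) W} :=
          (measureReal_mono hsub (measure_ne_top _ _)).trans (measureReal_biUnion_finset_le _ _)
      _ ≤ ∑ j ∈ Finset.range J, (1 + max C 0 * m) * Real.exp (-c * (m : ℝ) ^ r) :=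
          Finset.sum_le_sum fun j _ => hclass j
      _ = J * ((1 + max C 0 * m) * Real.exp (-c * (m : ℝ) ^ r)) := by simp
      _ ≤ J * ((n + max C 0 * n) * Real.exp (-c * ((2 * J * N)⁻¹ * n) ^ r)) := by
          gcongr ?_ * ((?_ + ?_ * ?_) * Real.exp ?_)
          · exact hm1'.trans hmn
          · rw [neg_mul, neg_mul, neg_le_neg_iff]
            gcongr
      _ = J * (1 + max C 0) * n * Real.exp (-(c * (2 * J * N)⁻¹ ^ r) * (n : ℝ) ^ r) := by
          rw [Real.mul_rpow (by positivity) hn0.le]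
          ring_nf

lemma eventually_pow_mul_exp_le {A c B r : ℝ} (hr : 0 < r) (hA : 0 ≤ A) (k : ℕ)
    (hB : B + 1 ≤ c * k) :
    ∀ᶠ n : ℕ in atTop, (A * n * Real.exp (-c * (n : ℝ) ^ r)) ^ k ≤ Real.exp (-B * (n : ℝ) ^ r) := by
  have h1 : Tendsto (fun n : ℕ => A ^ k * (((n : ℝ) ^ r) ^ ((k : ℝ) / r) *
      Real.exp (-1 * (n : ℝ) ^ r))) atTop (𝓝 (A ^ k * 0)) :=
    ((tendsto_rpow_mul_exp_neg_mul_atTop_nhds_zero ((k : ℝ) / r) 1 one_pos).comp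
      ((tendsto_rpow_atTop hr).comp tendsto_natCast_atTop_atTop)).const_mul _
  rw [mul_zero] at h1
  filter_upwards [h1.eventually_le_const one_pos] with n hn
  have h2 : ((n : ℝ) ^ r) ^ ((k : ℝ) / r) = (n : ℝ) ^ k := by
    rw [← Real.rpow_mul (by positivity), mul_div_cancel₀ _ hr.ne', Real.rpow_natCast]
  rw [h2] at hn
  have h3 : Real.exp (-c * (n : ℝ) ^ r) ^ k ≤
      Real.exp (-1 * (n : ℝ) ^ r) * Real.exp (-B * (n : ℝ) ^ r) := by
    rw [← Real.exp_nat_mul, ← Real.exp_add]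
    refine Real.exp_le_exp.2 ?_
    have : 0 ≤ (n : ℝ) ^ r := by positivity
    nlinarith
  calc (A * n * Real.exp (-c * (n : ℝ) ^ r)) ^ k
      = A ^ k * (n : ℝ) ^ k * Real.exp (-c * (n : ℝ) ^ r) ^ k := by rw [mul_pow, mul_pow]
    _ ≤ A ^ k * (n : ℝ) ^ k * (Real.exp (-1 * (n : ℝ) ^ r) * Real.exp (-B * (n : ℝ) ^ r)) := by
        gcongr
    _ = A ^ k * ((n : ℝ) ^ k * Real.exp (-1 * (n : ℝ) ^ r)) * Real.exp (-B * (n : ℝ) ^ r) := by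
        ring
    _ ≤ 1 * Real.exp (-B * (n : ℝ) ^ r) := by gcongr
    _ = _ := one_mul _

/-- Among sufficiently many translates of the segment from `0` to `⌊n x⌋`, all of which start within
bounded distance of `0`, at least one has a passage time of at most `n (l + ε)`, outside an event
whose probability decays at an arbitrarily prescribed rate. -/
lemma exists_translates (hν : ∀ᵐ t ∂ν, 0 ≤ t) {β r : ℝ} (hr : 0 < r) (hr1 : r ≤ 1) (hβ : 0 < β)
    (hint : Integrable (fun t => Real.exp (β * t ^ r)) ν) {x : Fin d → ℝ} {a b : Fin d}
    (hab : a ≠ b) (ha : x a ≠ 0) {l : ℝ}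
    (hl : Tendsto (fun t : ℝ => t⁻¹ * meanTime ν 0 (floorPt (t • x))) atTop (𝓝 l))
    {ε : ℝ} (hε : 0 < ε) (B : ℝ) :
    ∃ s : Finset ℕ, ∀ᶠ n : ℕ in atTop, (envLaw d ν).real
      {W | ∀ L ∈ s, n * (l + ε) <
        siteTime W (Pi.single b (L : ℤ)) (floorPt ((n : ℝ) • x) + Pi.single b (L : ℤ))} ≤
      Real.exp (-B * (n : ℝ) ^ r) := by
  classical
  obtain ⟨R, A, c, hc, hA, htube⟩ := exists_tube hν hr hr1 hβ hint ha hl hε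
  have hax : 0 < |x a| := abs_pos.2 ha
  obtain ⟨k, hk⟩ := exists_nat_ge ((B + 1) / c)
  rw [div_le_iff₀' hc] at hk
  -- tubes displaced by multiples of `h e_b` are disjoint, as `x` is not parallel to `e_b`
  obtain ⟨h, hh⟩ := exists_nat_gt (2 * R + 2 * R / |x a| * |x b|)
  refine ⟨(Finset.range k).image fun i => h * i, ?_⟩
  filter_upwards [htube, eventually_pow_mul_exp_le hr hA k hk] with n hn hexp
  obtain ⟨F, S, hFm, hFS, hSR, hF, hFtail⟩ := hn
  set z : ℕ → Fin d → ℤ := fun i => Pi.single b ((h * i : ℕ) : ℤ) with hz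
  have hdisj : Pairwise fun i i' : ℕ =>
      Disjoint (shiftEdge (z i) '' S) (shiftEdge (z i') '' S) := by
    intro i i' hii
    refine Set.disjoint_left.2 fun e he he' => ?_
    obtain ⟨y, hy⟩ : ∃ y, y ∈ e := ⟨_, e.out_fst_mem⟩
    obtain ⟨e₁, he₁, rfl⟩ := he
    obtain ⟨e₂, he₂, h12⟩ := he'
    have hy' := hy
    rw [← h12] at hy'
    rw [mem_shiftEdge] at hy hy'
    obtain ⟨t, ht⟩ := hSR _ he₁ _ hy
    obtain ⟨t', ht'⟩ := hSR _ he₂ _ hy'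
    have h1a := ht a
    have h2a := ht' a
    have h1b := ht b
    have h2b := ht' b
    simp only [hz, Pi.sub_apply, Pi.single_eq_of_ne hab, Pi.single_eq_same, sub_zero]
      at h1a h2a h1b h2b
    push_cast at h1b h2b
    have h3 : |t - t'| * |x a| ≤ 2 * R := by
      rw [← abs_mul, sub_mul]
      rw [abs_le] at h1a h2a ⊢
      constructor <;> linarith
    rw [← le_div_iff₀ hax] at h3
    have h4 : |h * (i : ℝ) - h * i'| ≤ 2 * R + |t - t'| * |x b| := by
      have h5 : |h * (i : ℝ) - h * i' + (t - t') * x b| ≤ 2 * R := by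
        rw [sub_mul]
        rw [abs_le] at h1b h2b ⊢
        constructor <;> linarith
      have h7 : h * (i : ℝ) - h * i' =
          (h * (i : ℝ) - h * i' + (t - t') * x b) - (t - t') * x b := by ring
      rw [h7, ← abs_mul]
      exact (abs_sub _ _).trans (by gcongr)
    have h5 : |t - t'| * |x b| ≤ 2 * R / |x a| * |x b| := by gcongr
    have h6 : (1 : ℝ) ≤ |(((i : ℤ) - i' : ℤ) : ℝ)| := by
      have : (1 : ℤ) ≤ |(i : ℤ) - i'| := Int.one_le_abs (by omega)
      exact_mod_cast this
    have h7 : (h : ℝ) * (i : ℝ) - h * i' = h * (((i : ℤ) - i' : ℤ) : ℝ) := by push_cast; ring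
    rw [h7, abs_mul, Nat.abs_cast] at h4
    have h8 : (h : ℝ) * 1 ≤ h * |(((i : ℤ) - i' : ℤ) : ℝ)| := by gcongr
    linarith
  set G : ℕ → Env d → ℝ := fun i W => F (shiftEnv (z i) W) with hG
  have hGm (i : ℕ) : Measurable (G i) := hFm.comp (measurable_shiftEnv _)
  have hind : iIndepFun G (envLaw d ν) :=
    iIndepFun_of_dependsOn ν hGm (fun i => dependsOn_comp_shiftEnv hFS (z i)) hdisj
  have hprod := hind.meas_biInter (S := Finset.range k) (s := fun i => {W | n * (l + ε) < G i W})
    fun i _ => ⟨Set.Ioi _, measurableSet_Ioi, rfl⟩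
  have hsub : (envLaw d ν) {W | ∀ L ∈ (Finset.range k).image fun i => h * i, n * (l + ε) <
        siteTime W (Pi.single b (L : ℤ)) (floorPt ((n : ℝ) • x) + Pi.single b (L : ℤ))} ≤
      (envLaw d ν) (⋂ i ∈ Finset.range k, {W | n * (l + ε) < G i W}) := by
    refine measure_mono_ae ?_
    filter_upwards [ae_nonneg ν hν] with W hW hWL
    refine Set.mem_iInter₂.2 fun i hi => ?_
    have h1 := hWL (h * i) (Finset.mem_image_of_mem _ hi)
    have h2 := hF (shiftEnv (z i) W) fun e => hW _
    rw [siteTime_shiftEnv, zero_add] at h2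
    exact h1.trans_le h2
  calc _ ≤ ((envLaw d ν) (⋂ i ∈ Finset.range k, {W | n * (l + ε) < G i W})).toReal :=
        ENNReal.toReal_mono (measure_ne_top _ _) hsub
    _ = ∏ i ∈ Finset.range k, (envLaw d ν).real {W | n * (l + ε) < G i W} := by
        rw [hprod, ENNReal.toReal_prod]
        rfl
    _ = ∏ i ∈ Finset.range k, (envLaw d ν).real {W | n * (l + ε) < F W} := by
        refine Finset.prod_congr rfl fun i _ => ?_
        exact measureReal_comp_shiftEnv (s := {W | n * (l + ε) < F W})
          (measurableSet_lt measurable_const hFm) (z i)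
    _ ≤ ∏ i ∈ Finset.range k, (A * n * Real.exp (-c * (n : ℝ) ^ r)) := by
        gcongr
    _ ≤ _ := by
        rw [Finset.prod_const, Finset.card_range]
        exact hexp

end Tubes

/-! ### The upper bound -/

section UpperBound

variable {ν : Measure ℝ} [IsProbabilityMeasure ν]

lemma eventually_mul_exp_le_exp {A κ κ' r : ℝ} (hr : 0 < r) (hκ : κ < κ') :
    ∀ᶠ n : ℕ in atTop, A * Real.exp (-κ' * (n : ℝ) ^ r) ≤ Real.exp (-κ * (n : ℝ) ^ r) := by
  have h1 : Tendsto (fun n : ℕ => Real.exp ((κ' - κ) * (n : ℝ) ^ r)) atTop atTop :=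
    Real.tendsto_exp_atTop.comp
      (((tendsto_rpow_atTop hr).comp tendsto_natCast_atTop_atTop).const_mul_atTop
        (sub_pos.2 hκ))
  filter_upwards [h1.eventually_ge_atTop A] with n hn
  calc A * Real.exp (-κ' * (n : ℝ) ^ r)
      ≤ Real.exp ((κ' - κ) * (n : ℝ) ^ r) * Real.exp (-κ' * (n : ℝ) ^ r) := by gcongr
    _ = _ := by rw [← Real.exp_add]; ring_nf

lemma eventually_disjoint_shiftEdge {S : Finset (Sym2 (Fin d → ℤ))} {x : Fin d → ℝ} {a : Fin d}
    (ha : x a ≠ 0) : ∀ᶠ n : ℕ in atTop,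
      Disjoint (S : Set (Sym2 (Fin d → ℤ))) (shiftEdge (floorPt ((n : ℝ) • x)) '' S) := by
  classical
  obtain ⟨R, hR⟩ : ∃ R : ℝ, ∀ e ∈ S, ∀ y ∈ e, |(y a : ℝ)| ≤ R := by
    obtain ⟨R, hR⟩ := (S.biUnion fun e => e.toFinset.image fun y => |(y a : ℝ)|).exists_le
    refine ⟨R, fun e he y hy => hR _ ?_⟩
    simp only [Finset.mem_biUnion, Finset.mem_image]
    exact ⟨e, he, y, by simpa using hy, rfl⟩
  have hax : 0 < |x a| := abs_pos.2 ha
  have hlim : Tendsto (fun n : ℕ => (n : ℝ) * |x a|) atTop atTop :=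
    tendsto_natCast_atTop_atTop.atTop_mul_const hax
  filter_upwards [hlim.eventually_gt_atTop (2 * R + 1)] with n hn
  refine Set.disjoint_left.2 fun e he he' => ?_
  obtain ⟨y, hy⟩ : ∃ y, y ∈ e := ⟨_, e.out_fst_mem⟩
  obtain ⟨e', he', rfl⟩ := he'
  have h1 := hR _ he y hy
  rw [mem_shiftEdge] at hy
  have h2 := hR _ he' _ hy
  simp only [floorPt, Pi.sub_apply, Pi.smul_apply, smul_eq_mul] at h2
  push_cast at h2
  have h3 := Int.floor_le (n * x a)
  have h4 := Int.lt_floor_add_one (n * x a)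
  have h5 : |(n : ℝ) * x a| ≤ 2 * R + 1 := by
    rw [abs_le] at h1 h2 ⊢
    constructor <;> linarith
  rw [abs_mul, Nat.abs_cast] at h5
  linarith

/-- The tail of a sum of two independent variables with a finite moment `E exp (β X ^ r)`. -/
lemma measureReal_lt_add_le {Ω : Type*} [MeasurableSpace Ω] {P : Measure Ω}
    [IsProbabilityMeasure P] {X Y : Ω → ℝ} (hX : Measurable X) (hY : Measurable Y)
    (hX0 : ∀ ω, 0 ≤ X ω) (hY0 : ∀ ω, 0 ≤ Y ω) (hind : IndepFun X Y P) {β r t : ℝ} (hr : 0 < r)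
    (hr1 : r ≤ 1) (hβ : 0 ≤ β) (ht : 0 ≤ t)
    (hXi : Integrable (fun ω => Real.exp (β * X ω ^ r)) P)
    (hYi : Integrable (fun ω => Real.exp (β * Y ω ^ r)) P) :
    P.real {ω | t < X ω + Y ω} ≤ Real.exp (-β * t ^ r) *
      ((∫ ω, Real.exp (β * X ω ^ r) ∂P) * ∫ ω, Real.exp (β * Y ω ^ r) ∂P) := by
  have hind' : IndepFun (fun ω => Real.exp (β * X ω ^ r)) (fun ω => Real.exp (β * Y ω ^ r)) P :=
    hind.comp (φ := fun t => Real.exp (β * t ^ r)) (ψ := fun t => Real.exp (β * t ^ r))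
      (by fun_prop) (by fun_prop)
  have hprod : Integrable (fun ω => Real.exp (β * X ω ^ r) * Real.exp (β * Y ω ^ r)) P :=
    hind'.integrable_mul hXi hYi
  have hle (ω : Ω) : Real.exp (β * (X ω + Y ω) ^ r) ≤
      Real.exp (β * X ω ^ r) * Real.exp (β * Y ω ^ r) := by
    rw [← Real.exp_add, ← mul_add]
    gcongr
    exact Real.rpow_add_le_add_rpow (hX0 ω) (hY0 ω) hr.le hr1
  have hint : Integrable (fun ω => Real.exp (β * (X ω + Y ω) ^ r)) P := by
    refine hprod.mono' (Measurable.aestronglyMeasurable (by fun_prop)) (ae_of_all _ fun ω => ?_)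
    rw [Real.norm_of_nonneg (Real.exp_pos _).le]
    exact hle ω
  refine (measureReal_lt_le_exp_mul_integral hβ hr.le ht hint).trans ?_
  gcongr
  refine (integral_mono hint hprod hle).trans_eq ?_
  exact hind'.integral_fun_mul_eq_mul_integral hXi.aestronglyMeasurable hYi.aestronglyMeasurable

/-- The upper bound: outside a negligible event some tube is fast, and then the excess `n ξ` has to
be spent on leaving `0` or on reaching `⌊n x⌋`. -/
lemma eventually_upper_tail_le (hν : ∀ᵐ t ∂ν, 0 ≤ t) {α r : ℝ} (hr : 0 < r) (hr1 : r ≤ 1)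
    (hα : 0 < α) (hint : ∀ β, 0 ≤ β → β < α → Integrable (fun t => Real.exp (β * t ^ r)) ν)
    {x : Fin d → ℝ} {a b : Fin d} (hab : a ≠ b) (ha : x a ≠ 0) {l : ℝ}
    (hl : Tendsto (fun t : ℝ => t⁻¹ * meanTime ν 0 (floorPt (t • x))) atTop (𝓝 l))
    {ξ κ : ℝ} (hξ : 0 < ξ) (hκ : κ < 2 * d * α * ξ ^ r) :
    ∀ᶠ n : ℕ in atTop, (envLaw d ν).real
      {W | n * (l + ξ) < siteTime W 0 (floorPt ((n : ℝ) • x))} ≤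
        Real.exp (-κ * (n : ℝ) ^ r) := by
  have hd0 : (0 : ℝ) < 2 * d * α := by
    have : 0 < d := Fin.pos a
    positivity
  have hξr : 0 < ξ ^ r := by positivity
  obtain ⟨β, hβ, hβα⟩ : ∃ β, max 0 (κ / ξ ^ r) < β ∧ β < 2 * d * α :=
    exists_between (max_lt hd0 ((div_lt_iff₀ hξr).2 hκ))
  have hβ0 : 0 < β := (le_max_left _ _).trans_lt hβ
  obtain ⟨ε, hε, hεξ, hκε⟩ : ∃ ε, 0 < ε ∧ ε < ξ ∧ κ < β * (ξ - ε) ^ r := by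
    have h1 : Tendsto (fun ε : ℝ => β * (ξ - ε) ^ r) (𝓝 0) (𝓝 (β * (ξ - 0) ^ r)) := by
      refine ((tendsto_const_nhds.sub tendsto_id).rpow_const ?_).const_mul β
      exact Or.inl (by simpa using hξ.ne')
    rw [sub_zero] at h1
    have h2 : κ < β * ξ ^ r := by
      rw [← div_lt_iff₀ hξr]
      exact (le_max_right _ _).trans_lt hβ
    have h3 : ∀ᶠ ε : ℝ in 𝓝[>] 0, κ < β * (ξ - ε) ^ r ∧ ε < ξ :=
      nhdsWithin_le_nhds ((h1.eventually_const_lt h2).and (eventually_lt_nhds hξ))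
    obtain ⟨ε, ⟨h4, h5⟩, h6⟩ := (h3.and self_mem_nhdsWithin).exists
    exact ⟨ε, h6, h5, h4⟩
  set κ' := β * (ξ - ε) ^ r with hκ'
  obtain ⟨s, hs⟩ := exists_translates hν hr hr1 (half_pos hα)
    (hint (α / 2) (half_pos hα).le (half_lt_self hα)) hab ha hl hε κ'
  obtain ⟨D, S, hDm, hDS, hD0, hD, hDi⟩ := exists_hub ν hν hr hr1 hint hβ0 hβα hab s
  set C := ∫ W, Real.exp (β * D W ^ r) ∂(envLaw d ν) with hC
  filter_upwards [hs, eventually_disjoint_shiftEdge (S := S) ha,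
    eventually_mul_exp_le_exp (A := 1 + C * C) hr hκε] with n hn hdisj hexp
  set q := floorPt ((n : ℝ) • x) with hq
  have hDm' : Measurable fun W => D (shiftEnv q W) := hDm.comp (measurable_shiftEnv q)
  have hDS' := dependsOn_comp_shiftEnv hDS q
  have hind : IndepFun D (fun W => D (shiftEnv q W)) (envLaw d ν) := by
    have := iIndepFun_of_dependsOn ν (κ := Bool)
      (f := fun i => bif i then D else fun W => D (shiftEnv q W))
      (S := fun i => bif i then S else shiftEdge q '' S)
      (by rintro (_ | _) <;> assumption) (by rintro (_ | _) <;> assumption)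
      (by rintro (_ | _) (_ | _) h <;> first | exact absurd rfl h | exact hdisj.symm | exact hdisj)
    exact this.indepFun (i := true) (j := false) (by simp)
  have hends : (envLaw d ν).real {W | n * (ξ - ε) < D W + D (shiftEnv q W)} ≤
      Real.exp (-κ' * (n : ℝ) ^ r) * (C * C) := by
    have h1 := measureReal_lt_add_le hDm hDm' hD0 (fun W => hD0 _) hind hr hr1 hβ0.le
      (t := n * (ξ - ε)) (mul_nonneg (by positivity) (by linarith)) hDi
      (integrable_comp_shiftEnv hDi q)
    have h2 : ∫ W, Real.exp (β * D (shiftEnv q W) ^ r) ∂(envLaw d ν) = C :=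
      integral_comp_shiftEnv (f := fun W => Real.exp (β * D W ^ r)) (by fun_prop) q
    rw [h2, Real.mul_rpow (by positivity) (by linarith)] at h1
    refine h1.trans_eq ?_
    congr 2
    rw [hκ']
    ring
  have hsub : (envLaw d ν).real {W | n * (l + ξ) < siteTime W 0 q} ≤ (envLaw d ν).real
      ({W | ∀ L ∈ s, n * (l + ε) < siteTime W (Pi.single b (L : ℤ)) (q + Pi.single b (L : ℤ))} ∪
        {W | n * (ξ - ε) < D W + D (shiftEnv q W)}) := by
    refine ENNReal.toReal_mono (measure_ne_top _ _) (measure_mono_ae ?_)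
    filter_upwards [ae_nonneg ν hν] with W hW (hWT : n * (l + ξ) < siteTime W 0 q)
    by_contra hcon
    have hcon' : ¬ ((∀ L ∈ s, n * (l + ε) <
        siteTime W (Pi.single b (L : ℤ)) (q + Pi.single b (L : ℤ))) ∨
          n * (ξ - ε) < D W + D (shiftEnv q W)) := hcon
    push Not at hcon'
    obtain ⟨⟨L, hL, h1⟩, h2⟩ := hcon'
    have h3 := siteTime_triangle hW 0 (Pi.single b (L : ℤ)) q
    have h4 := siteTime_triangle hW (Pi.single b (L : ℤ)) (q + Pi.single b (L : ℤ)) q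
    have h5 := hD W hW L hL
    have h6 := hD (shiftEnv q W) (fun e => hW _) L hL
    rw [siteTime_shiftEnv, zero_add, siteTime_comm, add_comm _ q] at h6
    nlinarith
  calc _ ≤ _ := hsub
    _ ≤ Real.exp (-κ' * (n : ℝ) ^ r) + Real.exp (-κ' * (n : ℝ) ^ r) * (C * C) :=
        (measureReal_union_le _ _).trans (add_le_add hn hends)
    _ = (1 + C * C) * Real.exp (-κ' * (n : ℝ) ^ r) := by ring
    _ ≤ _ := hexp

end UpperBound

/-! ### The lower bound -/

section LowerBound

/-- The set of the `2d` edges at the origin. -/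
def starEdges (d : ℕ) : Finset (Sym2 (Fin d → ℤ)) :=
  Finset.univ.image fun p : Fin d × Bool => s(0, Pi.single p.1 (if p.2 then 1 else -1))

lemma card_starEdges_le (d : ℕ) : (starEdges d).card ≤ 2 * d := by
  refine Finset.card_image_le.trans_eq ?_
  simp [mul_comm]

lemma mem_starEdges_of_adj {y : Fin d → ℤ} (h : (lattice d).Adj 0 y) :
    s(0, y) ∈ starEdges d := by
  have h : ∑ i, |y i| = 1 := by simpa [lattice] using h
  obtain ⟨j, -, hj⟩ : ∃ j ∈ Finset.univ, |y j| ≠ 0 :=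
    Finset.exists_ne_zero_of_sum_ne_zero (by rw [h]; exact one_ne_zero)
  have h1 : 1 ≤ |y j| := Int.one_le_abs (by simpa using hj)
  have h2 := Finset.add_sum_erase Finset.univ (fun i => |y i|) (Finset.mem_univ j)
  have h3 : 0 ≤ ∑ i ∈ Finset.univ.erase j, |y i| := Finset.sum_nonneg fun i _ => abs_nonneg _
  simp only [h] at h2
  have h4 : |y j| = 1 := by omega
  have h5 : ∑ i ∈ Finset.univ.erase j, |y i| = 0 := by omega
  have h6 (i) (hi : i ≠ j) : y i = 0 := by
    have := (Finset.sum_eq_zero_iff_of_nonneg fun i _ => abs_nonneg (y i)).1 h5 i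
      (by simp [hi])
    simpa using this
  refine Finset.mem_image.2 ⟨(j, decide (y j = 1)), Finset.mem_univ _, ?_⟩
  congr 2
  ext i
  by_cases hi : i = j
  · subst hi
    rcases eq_or_eq_neg_of_abs_eq h4 with h | h <;> simp [h]
  · simp [hi, h6 i hi]

open Classical in
/-- The configuration in which the weights of the edges at the origin are replaced by `0`. -/
noncomputable def zeroStar (W : Env d) : Env d := fun e => if e ∈ starEdges d then 0 else W e

lemma zeroStar_nonneg {W : Env d} (hW : ∀ e, 0 ≤ W e) (e) : 0 ≤ zeroStar W e := by
  unfold zeroStar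
  split_ifs
  exacts [le_rfl, hW e]

lemma zeroStar_le {W : Env d} (hW : ∀ e, 0 ≤ W e) (e) : zeroStar W e ≤ W e := by
  unfold zeroStar
  split_ifs
  exacts [hW e, le_rfl]

lemma measurable_zeroStar : Measurable (zeroStar (d := d)) := by
  refine measurable_pi_iff.2 fun e => ?_
  by_cases h : e ∈ starEdges d
  · simp [zeroStar, h]
  · simpa [zeroStar, h] using measurable_pi_apply e

/-- Every walk that leaves the origin starts with an edge at the origin. -/
lemma add_siteTime_zeroStar_le {W : Env d} (hW : ∀ e, 0 ≤ W e) {t : ℝ}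
    (ht : ∀ e ∈ starEdges d, t < W e) {q : Fin d → ℤ} (hq : q ≠ 0) :
    t + siteTime (zeroStar W) 0 q ≤ siteTime W 0 q := by
  refine le_ciInf fun γ => ?_
  have h0 := siteTime_le (zeroStar_nonneg hW) γ
  cases γ with
  | nil => exact absurd rfl hq
  | @cons _ v _ h γ =>
    have hmem := mem_starEdges_of_adj h
    have h1 := ht _ hmem
    have h2 : zeroStar W s(0, v) = 0 := by simp [zeroStar, hmem]
    have h3 : walkTime (zeroStar W) γ ≤ walkTime W γ :=
      List.sum_le_sum fun e _ => zeroStar_le hW e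
    simp only [walkTime, SimpleGraph.Walk.edges_cons, List.map_cons, List.sum_cons, h2] at h0 h3 ⊢
    linarith

/-- A self-avoiding walk uses each of the edges at the origin at most once. -/
lemma siteTime_le_siteTime_zeroStar_add {W : Env d} (hW : ∀ e, 0 ≤ W e) (q : Fin d → ℤ) :
    siteTime W 0 q ≤ siteTime (zeroStar W) 0 q + ∑ e ∈ starEdges d, W e := by
  classical
  rw [← sub_le_iff_le_add]
  refine le_ciInf fun γ => ?_
  rw [sub_le_iff_le_add]
  refine (siteTime_le hW γ.bypass).trans ?_
  have hsum (W : Env d) : walkTime W γ.bypass = ∑ e ∈ γ.bypass.edges.toFinset, W e :=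
    (List.sum_toFinset _ γ.bypass_isPath.isTrail.edges_nodup).symm
  have h1 := walkTime_bypass_le (zeroStar_nonneg hW) γ
  rw [hsum] at h1
  rw [hsum]
  have h2 : ∑ e ∈ γ.bypass.edges.toFinset, W e =
      ∑ e ∈ γ.bypass.edges.toFinset, zeroStar W e +
        ∑ e ∈ γ.bypass.edges.toFinset with e ∈ starEdges d, W e := by
    rw [Finset.sum_filter, ← Finset.sum_add_distrib]
    refine Finset.sum_congr rfl fun e _ => ?_
    unfold zeroStar
    split_ifs <;> simp
  have h3 : ∑ e ∈ γ.bypass.edges.toFinset with e ∈ starEdges d, W e ≤ ∑ e ∈ starEdges d, W e :=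
    Finset.sum_le_sum_of_subset_of_nonneg (fun e he => (Finset.mem_filter.1 he).2)
      fun e _ _ => hW e
  linarith

variable {ν : Measure ℝ} [IsProbabilityMeasure ν]

/-- If `T / n` has a bounded second moment, a mean tending to `l`, and exceeds `l + δ` with
probability tending to `0`, then it falls below `l - ε` with probability tending to `0`. -/
lemma tendsto_lower_tail (hν : ∀ᵐ t ∂ν, 0 ≤ t) (hsq : Integrable (fun t => t ^ 2) ν)
    {x : Fin d → ℝ} {l : ℝ}
    (hl : Tendsto (fun t : ℝ => t⁻¹ * meanTime ν 0 (floorPt (t • x))) atTop (𝓝 l))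
    (hup : ∀ δ : ℝ, 0 < δ → Tendsto (fun n : ℕ => (envLaw d ν).real
      {W | n * (l + δ) < siteTime W 0 (floorPt ((n : ℝ) • x))}) atTop (𝓝 0))
    {ε : ℝ} (hε : 0 < ε) :
    Tendsto (fun n : ℕ => (envLaw d ν).real
      {W | siteTime W 0 (floorPt ((n : ℝ) • x)) < n * (l - ε)}) atTop (𝓝 0) := by
  have hint1 : Integrable (fun t => t) ν := integrable_of_integrable_sq measurable_id hsq
  have hl0 : 0 ≤ l := by
    refine ge_of_tendsto hl ?_
    filter_upwards [eventually_gt_atTop 0] with t ht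
    have := meanTime_nonneg hν 0 (floorPt (t • x))
    positivity
  set C : ℝ := (∑ i, (|x i| + 1)) ^ 2 * ∫ t, t ^ 2 ∂ν with hC
  have hC0 : 0 ≤ C := by
    have : (0 : ℝ) ≤ ∫ t, t ^ 2 ∂ν := integral_nonneg fun t => by positivity
    positivity
  refine tendsto_order.2 ⟨fun ρ hρ => Eventually.of_forall fun n => hρ.trans_le measureReal_nonneg,
    fun ρ hρ => ?_⟩
  set δ := ε * ρ / 8 with hδ
  set η := ε * ρ / (8 * (C + 1)) with hη
  have hδ0 : 0 < δ := by positivity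
  have hη0 : 0 < η := by positivity
  have hηC : η * C ≤ ε * ρ / 8 := by
    rw [hη, div_mul_eq_mul_div, div_le_div_iff₀ (by positivity) (by positivity)]
    nlinarith [mul_pos hε hρ]
  have hlow := (hl.comp (tendsto_natCast_atTop_atTop (R := ℝ))).eventually_const_lt
    (show l - ε * ρ / 8 < l by linarith [mul_pos hε hρ])
  have hhigh := (hup δ hδ0).eventually_lt_const (show (0 : ℝ) < 4 * η * (ε * ρ / 8) by positivity)
  filter_upwards [hlow, hhigh, eventually_ge_atTop 1] with n hn1 hn2 hn
  have hn' : (1 : ℝ) ≤ n := by exact_mod_cast hn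
  have hn0 : (0 : ℝ) < n := by linarith
  set q := floorPt ((n : ℝ) • x)
  set T : Env d → ℝ := fun W => siteTime W 0 q with hT
  have hTm : Measurable T := measurable_siteTime 0 q
  set E₁ : Set (Env d) := {W | T W < n * (l - ε)} with hE₁
  set E₂ : Set (Env d) := {W | n * (l + δ) < T W} with hE₂
  have hE₁m : MeasurableSet E₁ := measurableSet_lt hTm measurable_const
  have hE₂m : MeasurableSet E₂ := measurableSet_lt measurable_const hTm
  obtain ⟨hTsq, hTsq'⟩ := integrable_sq_siteTime hν hsq 0 q
  have hsecond : ∫ W, T W ^ 2 ∂(envLaw d ν) ≤ n ^ 2 * C := by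
    refine hTsq'.trans ?_
    rw [hC, ← mul_assoc, ← mul_pow]
    have : (0 : ℝ) ≤ ∫ t, t ^ 2 ∂ν := integral_nonneg fun t => by positivity
    gcongr
    rw [Finset.mul_sum]
    refine Finset.sum_le_sum fun i _ => ?_
    have h1 := abs_floor_sub_floor_le 0 (n * x i)
    simp only [q, floorPt, Pi.zero_apply, Pi.smul_apply, smul_eq_mul]
    simp only [Int.floor_zero, zero_sub, abs_neg, abs_mul, Nat.abs_cast, Int.cast_zero] at h1 ⊢
    linarith
  -- `T 1_{E₂} ≤ n (η (T / n) ^ 2 + (1 / 4η) 1_{E₂})`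
  have hpt (W : Env d) (hW : ∀ e, 0 ≤ W e) : T W ≤ n * (l + δ) +
      (-(n * (ε + δ)) * E₁.indicator 1 W + (η / n * T W ^ 2 +
        n / (4 * η) * E₂.indicator 1 W)) := by
    have hT0 : 0 ≤ T W := siteTime_nonneg hW 0 q
    have hsq0 : 0 ≤ η / n * T W ^ 2 := by positivity
    have hind2 : 0 ≤ n / (4 * η) * E₂.indicator 1 W :=
      mul_nonneg (by positivity) (Set.indicator_nonneg (fun _ _ => zero_le_one) W)
    by_cases h1 : W ∈ E₁
    · have h1' : T W < n * (l - ε) := h1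
      simp only [Set.indicator_of_mem h1, Pi.one_apply]
      linarith
    · rw [Set.indicator_of_notMem h1]
      by_cases h2 : W ∈ E₂
      · simp only [Set.indicator_of_mem h2, Pi.one_apply]
        have h3 : T W ≤ η / n * T W ^ 2 + n / (4 * η) * 1 := by
          have h4 : η / n * T W ^ 2 + n / (4 * η) * 1 - T W =
              (2 * η * T W - n) ^ 2 / (4 * η * n) := by field_simp; ring
          have h5 : 0 ≤ (2 * η * T W - n) ^ 2 / (4 * η * n) := by positivity
          linarith
        have : 0 ≤ n * (l + δ) := by positivity
        linarith
      · have h2' : T W ≤ n * (l + δ) := not_lt.1 h2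
        linarith
  have hi1 : Integrable (E₁.indicator (1 : Env d → ℝ)) (envLaw d ν) :=
    (integrable_const (1 : ℝ)).indicator hE₁m
  have hi2 : Integrable (E₂.indicator (1 : Env d → ℝ)) (envLaw d ν) :=
    (integrable_const (1 : ℝ)).indicator hE₂m
  have hmean : meanTime ν 0 q ≤ n * (l + δ) + (-(n * (ε + δ)) * (envLaw d ν).real E₁ +
      (η / n * ∫ W, T W ^ 2 ∂(envLaw d ν) + n / (4 * η) * (envLaw d ν).real E₂)) := by
    have h3 : Integrable (fun W => η / n * T W ^ 2) (envLaw d ν) := hTsq.const_mul _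
    have h4 := hi1.const_mul (-(n * (ε + δ)))
    have h5 := hi2.const_mul (n / (4 * η))
    have h35 : Integrable (fun W => η / n * T W ^ 2 + n / (4 * η) * E₂.indicator 1 W)
        (envLaw d ν) := h3.add h5
    have h435 : Integrable (fun W => -(n * (ε + δ)) * E₁.indicator 1 W +
        (η / n * T W ^ 2 + n / (4 * η) * E₂.indicator 1 W)) (envLaw d ν) := h4.add h35
    rw [← integral_indicator_one hE₁m, ← integral_indicator_one hE₂m, ← integral_const_mul,
      ← integral_const_mul, ← integral_const_mul, ← integral_add h3 h5,
      ← integral_add h4 h35]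
    have h6 : (n : ℝ) * (l + δ) = ∫ _W : Env d, (n : ℝ) * (l + δ) ∂(envLaw d ν) := by simp
    rw [h6, ← integral_add (integrable_const _) h435]
    refine integral_mono_ae (integrable_siteTime hν hint1 0 q)
      ((integrable_const _).add h435) ?_
    filter_upwards [ae_nonneg ν hν] with W hW using hpt W hW
  have h1 : l - ε * ρ / 8 < (n : ℝ)⁻¹ * meanTime ν 0 q := hn1
  rw [lt_inv_mul_iff₀ hn0] at h1
  have h2 : η / n * ∫ W, T W ^ 2 ∂(envLaw d ν) ≤ n * (ε * ρ / 8) := by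
    calc η / n * ∫ W, T W ^ 2 ∂(envLaw d ν) ≤ η / n * (n ^ 2 * C) := by gcongr
      _ = n * (η * C) := by field_simp
      _ ≤ _ := by gcongr
  have h3 : n / (4 * η) * (envLaw d ν).real E₂ ≤ n * (ε * ρ / 8) := by
    calc n / (4 * η) * (envLaw d ν).real E₂ ≤ n / (4 * η) * (4 * η * (ε * ρ / 8)) := by
          gcongr
      _ = _ := by field_simp
  have h4 : n * ((ε + δ) * (envLaw d ν).real E₁) < n * (ε * ρ / 2) := by
    have : δ = ε * ρ / 8 := hδ
    nlinarith
  have h5 : (ε + δ) * (envLaw d ν).real E₁ < ε * ρ / 2 := lt_of_mul_lt_mul_left h4 hn0.le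
  have h6 : ε * (envLaw d ν).real E₁ ≤ (ε + δ) * (envLaw d ν).real E₁ := by
    gcongr
    linarith
  have h7 : ε * (envLaw d ν).real E₁ < ε * ρ := by linarith [mul_pos hε hρ]
  exact lt_of_mul_lt_mul_left h7 hε.le

/-- The lower bound: all edges at the origin are slow, independently of all other edges. -/
lemma eventually_le_upper_tail (hd : 2 ≤ d) (hν : ∀ᵐ t ∂ν, 0 ≤ t) {α r c : ℝ} (hr : 0 < r)
    (hα : 0 < α) (hc : 0 < c) (hint : Integrable (fun t => t) ν)
    (htail : ∀ᶠ t : ℝ in atTop, c * Real.exp (-α * t ^ r) ≤ ν.real (Set.Ioi t))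
    {x : Fin d → ℝ} {a : Fin d} (ha : x a ≠ 0) {l : ℝ}
    (hlow : ∀ ε : ℝ, 0 < ε → Tendsto (fun n : ℕ => (envLaw d ν).real
      {W | siteTime W 0 (floorPt ((n : ℝ) • x)) < n * (l - ε)}) atTop (𝓝 0))
    {ξ κ : ℝ} (hξ : 0 < ξ) (hκ : 2 * d * α * ξ ^ r < κ) :
    ∀ᶠ n : ℕ in atTop, Real.exp (-κ * (n : ℝ) ^ r) ≤ (envLaw d ν).real
      {W | n * (l + ξ) < siteTime W 0 (floorPt ((n : ℝ) • x))} := by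
  have hd0 : (0 : ℝ) < 2 * d * α := by positivity
  obtain ⟨ε, hε, hκε⟩ : ∃ ε, 0 < ε ∧ 2 * d * α * (ξ + 2 * ε) ^ r < κ := by
    have h1 : Tendsto (fun ε : ℝ => 2 * d * α * (ξ + 2 * ε) ^ r) (𝓝 0)
        (𝓝 (2 * d * α * (ξ + 2 * 0) ^ r)) := by
      refine ((tendsto_const_nhds.add (tendsto_id.const_mul 2)).rpow_const ?_).const_mul _
      exact Or.inl (by simpa using hξ.ne')
    rw [mul_zero, add_zero] at h1
    have h3 : ∀ᶠ ε : ℝ in 𝓝[>] 0, 2 * d * α * (ξ + 2 * ε) ^ r < κ :=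
      nhdsWithin_le_nhds (h1.eventually_lt_const hκ)
    obtain ⟨ε, h4, h5⟩ := (h3.and self_mem_nhdsWithin).exists
    exact ⟨ε, h5, h4⟩
  -- the contribution of the edges at the origin to the passage time is negligible
  have hstar : Tendsto (fun n : ℕ => (envLaw d ν).real
      {W | n * (ε / 2) ≤ ∑ e ∈ starEdges d, W e}) atTop (𝓝 0) := by
    have hint' : Integrable (fun W : Env d => ∑ e ∈ starEdges d, W e) (envLaw d ν) :=
      integrable_finsetSum _ fun e _ => integrable_eval ν hint e
    have hpos : 0 ≤ᵐ[envLaw d ν] fun W : Env d => ∑ e ∈ starEdges d, W e := by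
      filter_upwards [ae_nonneg ν hν] with W hW using Finset.sum_nonneg fun e _ => hW e
    refine squeeze_zero' (Eventually.of_forall fun n => measureReal_nonneg) ?_
      ((tendsto_const_div_atTop_nhds_zero_nat
        ((∫ W, ∑ e ∈ starEdges d, W e ∂(envLaw d ν)) / (ε / 2))))
    filter_upwards [eventually_ge_atTop 1] with n hn
    have hn0 : (0 : ℝ) < n := by exact_mod_cast hn
    have := mul_meas_ge_le_integral_of_nonneg hpos hint' (n * (ε / 2))
    rw [div_div, le_div_iff₀ (by positivity)]
    linarith
  have hstar_pos : 0 < c ^ (2 * d) / 2 := by positivity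
  have hmul : Tendsto (fun n : ℕ => (n : ℝ) * (ξ + 2 * ε)) atTop atTop :=
    tendsto_natCast_atTop_atTop.atTop_mul_const (by positivity)
  have hnx : ∀ᶠ n : ℕ in atTop, floorPt ((n : ℝ) • x) ≠ 0 := by
    have h1 : Tendsto (fun n : ℕ => (n : ℝ) * |x a|) atTop atTop :=
      tendsto_natCast_atTop_atTop.atTop_mul_const (abs_pos.2 ha)
    filter_upwards [h1.eventually_ge_atTop 1] with n hn h0
    have h2 : ⌊(n : ℝ) * x a⌋ = 0 := by simpa [floorPt] using congrFun h0 a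
    rw [Int.floor_eq_zero_iff] at h2
    have h3 : |(n : ℝ) * x a| < 1 := by rw [abs_of_nonneg h2.1]; exact h2.2
    rw [abs_mul, Nat.abs_cast] at h3
    linarith
  filter_upwards [
    (hlow (ε / 2) (half_pos hε)).eventually_lt_const (show (0 : ℝ) < 1 / 4 by norm_num),
    hstar.eventually_lt_const (show (0 : ℝ) < 1 / 4 by norm_num), hmul.eventually htail, hnx,
    eventually_mul_exp_le_exp (A := (c ^ (2 * d) / 2)⁻¹) hr hκε, eventually_ge_atTop 1]
    with n hn1 hn2 hn3 hq hn4 hn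
  have hn0 : (0 : ℝ) < n := by exact_mod_cast hn
  set q := floorPt ((n : ℝ) • x)
  set t : ℝ := n * (ξ + 2 * ε) with ht
  set A : Env d → Prop := fun W => ∀ e ∈ starEdges d, t < W e with hA
  set B : Env d → Prop := fun W => n * (l - ε) ≤ siteTime (zeroStar W) 0 q with hB
  have hAm : MeasurableSet {W | A W} := by
    have : {W | A W} = ⋂ e ∈ starEdges d, {W : Env d | t < W e} := by ext W; simp [hA]
    rw [this]
    exact Finset.measurableSet_biInter _ fun e _ =>
      measurableSet_lt measurable_const (measurable_pi_apply e)
  have hBm : MeasurableSet {W | B W} :=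
    measurableSet_le measurable_const ((measurable_siteTime 0 q).comp measurable_zeroStar)
  have hAd : DependsOn A (starEdges d : Set (Sym2 (Fin d → ℤ))) := fun W W' h =>
    propext (forall₂_congr fun e he => by rw [h e he])
  have hBd : DependsOn B ((starEdges d : Set (Sym2 (Fin d → ℤ)))ᶜ) := fun W W' h => by
    have : zeroStar W = zeroStar W' := by
      ext e
      unfold zeroStar
      split_ifs with he
      · rfl
      · exact h e he
    simp only [hB, this]
  have hind : IndepFun A B (envLaw d ν) := by
    have := iIndepFun_of_dependsOn ν (κ := Bool) (f := fun i => bif i then A else B)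
      (S := fun i => bif i then (starEdges d : Set (Sym2 (Fin d → ℤ))) else
        (starEdges d : Set (Sym2 (Fin d → ℤ)))ᶜ)
      (by rintro (_ | _); exacts [measurableSet_setOfPred.1 hBm, measurableSet_setOfPred.1 hAm])
      (by rintro (_ | _) <;> assumption)
      (by rintro (_ | _) (_ | _) h <;>
        first | exact absurd rfl h | exact disjoint_compl_left | exact disjoint_compl_right)
    exact this.indepFun (i := true) (j := false) (by simp)
  have hAB : (envLaw d ν).real ({W | A W} ∩ {W | B W}) =
      (envLaw d ν).real {W | A W} * (envLaw d ν).real {W | B W} := by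
    have := hind.measure_inter_preimage_eq_mul {True} {True} trivial trivial
    have hp (p : Env d → Prop) : p ⁻¹' {True} = {W | p W} := by ext W; simp
    rw [hp, hp] at this
    simp only [measureReal_def, this, ENNReal.toReal_mul]
  have hPB : 1 / 2 ≤ (envLaw d ν).real {W | B W} := by
    have h1 : (envLaw d ν).real {W | B W}ᶜ ≤ (envLaw d ν).real
        ({W | siteTime W 0 q < n * (l - ε / 2)} ∪
          {W | n * (ε / 2) ≤ ∑ e ∈ starEdges d, W e}) := by
      refine ENNReal.toReal_mono (measure_ne_top _ _) (measure_mono_ae ?_)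
      filter_upwards [ae_nonneg ν hν] with W hW hWB
      have hWB : siteTime (zeroStar W) 0 q < n * (l - ε) := not_le.1 hWB
      by_contra hcon
      have hcon' : ¬ (siteTime W 0 q < n * (l - ε / 2) ∨
        n * (ε / 2) ≤ ∑ e ∈ starEdges d, W e) := hcon
      push Not at hcon'
      have := siteTime_le_siteTime_zeroStar_add hW q
      linarith [hcon'.1, hcon'.2]
    have h2 := h1.trans (measureReal_union_le _ _)
    rw [probReal_compl_eq_one_sub hBm] at h2
    linarith
  have hPA : c ^ (2 * d) * Real.exp (-(2 * d * α * (ξ + 2 * ε) ^ r) * (n : ℝ) ^ r) ≤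
      (envLaw d ν).real {W | A W} := by
    have h1 : {W | A W} = Set.pi (starEdges d) fun _ => Set.Ioi t := by
      ext W; simp [hA, Set.mem_pi]
    rw [h1, measureReal_def, envLaw, Measure.infinitePi_pi _ fun _ _ => measurableSet_Ioi,
      ENNReal.toReal_prod, Finset.prod_const]
    calc c ^ (2 * d) * Real.exp (-(2 * d * α * (ξ + 2 * ε) ^ r) * (n : ℝ) ^ r)
        = (c * Real.exp (-α * t ^ r)) ^ (2 * d) := by
          rw [mul_pow, ← Real.exp_nat_mul, ht, Real.mul_rpow (by positivity) (by positivity)]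
          push_cast
          ring_nf
      _ ≤ (ν.real (Set.Ioi t)) ^ (2 * d) := by gcongr
      _ ≤ (ν.real (Set.Ioi t)) ^ (starEdges d).card :=
          pow_le_pow_of_le_one measureReal_nonneg measureReal_le_one (card_starEdges_le d)
  have hsub : (envLaw d ν).real ({W | A W} ∩ {W | B W}) ≤
      (envLaw d ν).real {W | n * (l + ξ) < siteTime W 0 q} := by
    refine ENNReal.toReal_mono (measure_ne_top _ _) (measure_mono_ae ?_)
    filter_upwards [ae_nonneg ν hν] with W hW hWAB
    have h1 := add_siteTime_zeroStar_le hW (t := t) hWAB.1 hq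
    have h2 : n * (l - ε) ≤ siteTime (zeroStar W) 0 q := hWAB.2
    have h3 : n * (l + ξ) < siteTime W 0 q := by nlinarith
    exact h3
  rw [inv_mul_le_iff₀ hstar_pos] at hn4
  calc Real.exp (-κ * (n : ℝ) ^ r)
      ≤ c ^ (2 * d) * Real.exp (-(2 * d * α * (ξ + 2 * ε) ^ r) * (n : ℝ) ^ r) * (1 / 2) := by
        linarith
    _ ≤ (envLaw d ν).real {W | A W} * (envLaw d ν).real {W | B W} := by gcongr
    _ = _ := hAB.symm
    _ ≤ _ := hsub

end LowerBound

/-! ### The limit, and the transfer to an arbitrary family of weights -/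

lemma tendsto_log_upper_tail (hd : 2 ≤ d) {ν : Measure ℝ} [IsProbabilityMeasure ν]
    (hν : ∀ᵐ t ∂ν, 0 ≤ t) {α r c₁ c₂ : ℝ} (hα : 0 < α) (hr : 0 < r) (hr1 : r ≤ 1) (hc₁ : 0 < c₁)
    (htail : ∀ᶠ t : ℝ in atTop, c₁ * Real.exp (-α * t ^ r) ≤ ν.real (Set.Ioi t) ∧
      ν.real (Set.Ioi t) ≤ c₂ * Real.exp (-α * t ^ r)) :
    Integrable (fun t => t) ν ∧ ∀ (x : Fin d → ℝ) (l : ℝ), x ≠ 0 →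
      Tendsto (fun t : ℝ => t⁻¹ * meanTime ν 0 (floorPt (t • x))) atTop (𝓝 l) →
      ∀ ξ : ℝ, 0 < ξ → Tendsto (fun n : ℕ => 1 / (n : ℝ) ^ r * Real.log ((envLaw d ν).real
        {W | n * (l + ξ) < siteTime W 0 (floorPt ((n : ℝ) • x))})) atTop
        (𝓝 (-2 * d * α * ξ ^ r)) := by
  have hint (β : ℝ) (hβ : 0 ≤ β) (hβα : β < α) :
      Integrable (fun t => Real.exp (β * t ^ r)) ν :=
    integrable_exp_of_tail (X := fun t => t) measurable_id hν hr hβ hβα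
      (htail.mono fun t ht => ht.2)
  have hsq : Integrable (fun t => t ^ 2) ν :=
    integrable_sq_of_integrable_exp measurable_id hν (half_pos hα) hr
      (hint (α / 2) (half_pos hα).le (half_lt_self hα))
  have hint1 : Integrable (fun t => t) ν := integrable_of_integrable_sq measurable_id hsq
  refine ⟨hint1, fun x l hx hl ξ hξ => ?_⟩
  obtain ⟨a, ha⟩ : ∃ a, x a ≠ 0 := Function.ne_iff.1 hx
  obtain ⟨b, hab⟩ : ∃ b, a ≠ b := by
    have : Nontrivial (Fin d) := Fin.nontrivial_iff_two_le.2 hd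
    obtain ⟨b, hb⟩ := exists_ne a
    exact ⟨b, hb.symm⟩
  have hd0 : (0 : ℝ) < d := by positivity
  have hup {ξ κ : ℝ} (hξ : 0 < ξ) (hκ : κ < 2 * d * α * ξ ^ r) :=
    eventually_upper_tail_le hν hr hr1 hα hint hab ha hl hξ hκ
  have hup0 (δ : ℝ) (hδ : 0 < δ) : Tendsto (fun n : ℕ => (envLaw d ν).real
      {W | n * (l + δ) < siteTime W 0 (floorPt ((n : ℝ) • x))}) atTop (𝓝 0) := by
    have hκ : 0 < 2 * d * α * δ ^ r := by positivity
    refine squeeze_zero' (Eventually.of_forall fun n => measureReal_nonneg)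
      (hup hδ (half_lt_self hκ)) ?_
    refine Real.tendsto_exp_atBot.comp ?_
    exact ((tendsto_rpow_atTop hr).comp tendsto_natCast_atTop_atTop).const_mul_atTop_of_neg
      (by linarith)
  have hlow (ε : ℝ) (hε : 0 < ε) := tendsto_lower_tail hν hsq hl hup0 hε
  have hlb {κ : ℝ} (hκ : 2 * d * α * ξ ^ r < κ) :=
    eventually_le_upper_tail hd hν hr hα hc₁ hint1 (htail.mono fun t ht => ht.1) ha hlow hξ hκ
  refine tendsto_order.2 ⟨fun v hv => ?_, fun v hv => ?_⟩
  · obtain ⟨κ, hκ, hκv⟩ : ∃ κ, 2 * d * α * ξ ^ r < κ ∧ κ < -v :=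
      exists_between (by linarith)
    filter_upwards [hlb hκ, eventually_ge_atTop 1] with n hn hn1
    have hnr : 0 < (n : ℝ) ^ r := by positivity
    have h1 := (Real.le_log_iff_exp_le ((Real.exp_pos _).trans_le hn)).2 hn
    have h2 : -κ ≤ 1 / (n : ℝ) ^ r * Real.log ((envLaw d ν).real
        {W | n * (l + ξ) < siteTime W 0 (floorPt ((n : ℝ) • x))}) := by
      rw [one_div_mul_eq_div, le_div_iff₀ hnr]
      exact h1
    linarith
  · obtain ⟨κ, hκ, hκv⟩ : ∃ κ, -v < κ ∧ κ < 2 * d * α * ξ ^ r :=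
      exists_between (by linarith)
    -- the lower bound shows that the probability is positive, so that its logarithm is meaningful
    filter_upwards [hup hξ hκv, hlb (lt_add_one _), eventually_ge_atTop 1] with n hn hn' hn1
    have hnr : 0 < (n : ℝ) ^ r := by positivity
    have h1 := (Real.log_le_iff_le_exp ((Real.exp_pos _).trans_le hn')).2 hn
    have h2 : 1 / (n : ℝ) ^ r * Real.log ((envLaw d ν).real
        {W | n * (l + ξ) < siteTime W 0 (floorPt ((n : ℝ) • x))}) ≤ -κ := by
      rw [one_div_mul_eq_div, div_le_iff₀ hnr]
      exact h1
    linarith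

lemma measurable_pathTime {x y : Fin d → ℤ} (γ : (lattice d).Walk x y) :
    Measurable fun w : Edge d → ℝ => pathTime w γ := by
  induction γ with
  | nil => exact measurable_const
  | cons h γ ih => exact (measurable_pi_apply _).add ih

lemma measurable_passageTime (x y : Fin d → ℝ) :
    Measurable fun w : Edge d → ℝ => passageTime w x y :=
  Measurable.iInf fun γ => measurable_pathTime γ

lemma passageTime_eq_siteTime (W : Env d) (x : Fin d → ℝ) :
    passageTime (fun e : Edge d => W e) 0 x = siteTime W 0 (floorPt x) := by
  have h0 : floorPt (0 : Fin d → ℝ) = 0 := by ext i; simp [floorPt]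
  simp only [passageTime, pathTime_eq_walkTime]
  change siteTime W (floorPt 0) (floorPt x) = siteTime W 0 (floorPt x)
  rw [h0]

lemma nonempty_edge (hd : 2 ≤ d) : Nonempty (Edge d) := by
  refine ⟨⟨s(0, Pi.single ⟨0, by omega⟩ 1), ?_⟩⟩
  simp only [SimpleGraph.mem_edgeSet, lattice, Pi.zero_apply, zero_sub, abs_neg]
  rw [Finset.sum_eq_single_of_mem _ (Finset.mem_univ (⟨0, by omega⟩ : Fin d))
    fun j _ hj => by simp [Pi.single_eq_of_ne hj]]
  simp

section Transfer

variable {Ω : Type*} [MeasurableSpace Ω] {P : Measure Ω} [IsProbabilityMeasure P]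
  {τ : Edge d → Ω → ℝ}

lemma map_eq_map_envLaw (hmeas : ∀ e, Measurable (τ e)) (hindep : iIndepFun τ P)
    {ν : Measure ℝ} [IsProbabilityMeasure ν] (hlaw : ∀ e, P.map (τ e) = ν) :
    P.map (fun ω e => τ e ω) = (envLaw d ν).map fun W (e : Edge d) => W e := by
  rw [(iIndepFun_iff_map_fun_eq_infinitePi_map hmeas).1 hindep, envLaw,
    Measure.map_infinitePi_infinitePi_of_inj (P := fun _ : Sym2 (Fin d → ℤ) => ν)
      Subtype.val_injective]
  simp only [hlaw]

/-- The theorem for stretched exponential weights. Nothing is required of the atom at `0`. -/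
lemma upper_tail_of_tail (hd : 2 ≤ d) (hmeas : ∀ e, Measurable (τ e))
    (hnonneg : ∀ e, ∀ᵐ ω ∂P, 0 ≤ τ e ω) (hindep : iIndepFun τ P)
    (hident : ∀ e e', IdentDistrib (τ e) (τ e') P P) {α r c₁ c₂ : ℝ} (hα : 0 < α) (hr : 0 < r)
    (hr1 : r ≤ 1) (hc₁ : 0 < c₁)
    (htail : ∀ e, ∀ᶠ t : ℝ in atTop, c₁ * Real.exp (-α * t ^ r) ≤ P.real {ω | t < τ e ω} ∧
      P.real {ω | t < τ e ω} ≤ c₂ * Real.exp (-α * t ^ r))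
    (x : Fin d → ℝ) (hx : x ≠ 0) :
    (∀ t : ℝ, Integrable (fun ω => passageTime (fun e => τ e ω) 0 (t • x)) P) ∧
    Tendsto (fun t : ℝ => t⁻¹ * ∫ ω, passageTime (fun e => τ e ω) 0 (t • x) ∂P) atTop
      (𝓝 (timeConstant P τ x)) ∧
    ∀ ξ : ℝ, 0 < ξ →
      Tendsto (fun n : ℕ => 1 / (n : ℝ) ^ r * Real.log (P.real
          {ω | n * (timeConstant P τ x + ξ) <
            passageTime (fun e => τ e ω) 0 ((n : ℝ) • x)}))
        atTop (𝓝 (-2 * d * α * ξ ^ r)) := by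
  obtain ⟨e₀⟩ := nonempty_edge hd
  set ν : Measure ℝ := P.map (τ e₀) with hνdef
  have : IsProbabilityMeasure ν := Measure.isProbabilityMeasure_map (hmeas e₀).aemeasurable
  have hlaw (e) : P.map (τ e) = ν := (hident e e₀).map_eq
  have hmap := map_eq_map_envLaw hmeas hindep hlaw
  have hν : ∀ᵐ t ∂ν, 0 ≤ t := (ae_map_iff (hmeas e₀).aemeasurable measurableSet_Ici).2 (hnonneg e₀)
  have htail' : ∀ᶠ t : ℝ in atTop, c₁ * Real.exp (-α * t ^ r) ≤ ν.real (Set.Ioi t) ∧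
      ν.real (Set.Ioi t) ≤ c₂ * Real.exp (-α * t ^ r) := by
    filter_upwards [htail e₀] with t ht
    rw [hνdef, map_measureReal_apply (hmeas e₀) measurableSet_Ioi]
    exact ht
  obtain ⟨hint, hmain⟩ := tendsto_log_upper_tail hd hν hα hr hr1 hc₁ htail'
  have hτm : Measurable fun ω (e : Edge d) => τ e ω := measurable_pi_iff.2 hmeas
  have hRm : Measurable fun (W : Env d) (e : Edge d) => W e :=
    measurable_pi_iff.2 fun e => measurable_pi_apply _
  have hintegral (y : Fin d → ℝ) :
      ∫ ω, passageTime (fun e => τ e ω) 0 y ∂P = meanTime ν 0 (floorPt y) := by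
    have hm := (measurable_passageTime 0 y).aestronglyMeasurable
      (μ := P.map fun ω (e : Edge d) => τ e ω)
    rw [← integral_map hτm.aemeasurable hm]
    rw [hmap] at hm ⊢
    rw [integral_map hRm.aemeasurable hm]
    simp only [passageTime_eq_siteTime, meanTime]
  have hprob (y : Fin d → ℝ) (v : ℝ) : P.real {ω | v < passageTime (fun e => τ e ω) 0 y} =
      (envLaw d ν).real {W | v < siteTime W 0 (floorPt y)} := by
    have hs : MeasurableSet {w : Edge d → ℝ | v < passageTime w 0 y} :=
      measurableSet_lt measurable_const (measurable_passageTime 0 y)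
    have h1 : P.real {ω | v < passageTime (fun e => τ e ω) 0 y} = _ :=
      (map_measureReal_apply (μ := P) hτm hs).symm
    rw [h1, hmap, map_measureReal_apply hRm hs]
    congr 1
    ext W
    exact iff_of_eq (congrArg (v < ·) (passageTime_eq_siteTime W y))
  obtain ⟨l, hl⟩ := exists_tendsto_meanTime hν hint x
  have hl' : Tendsto (fun t : ℝ => t⁻¹ * ∫ ω, passageTime (fun e => τ e ω) 0 (t • x) ∂P) atTop
      (𝓝 l) := by
    simpa only [hintegral] using hl
  have htc : timeConstant P τ x = l := hl'.limUnder_eq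
  refine ⟨fun t => ?_, htc ▸ hl', fun ξ hξ => ?_⟩
  · have hm := (measurable_passageTime 0 (t • x)).aestronglyMeasurable
      (μ := P.map fun ω (e : Edge d) => τ e ω)
    refine (integrable_map_measure hm hτm.aemeasurable).1 ?_
    rw [hmap] at hm ⊢
    refine (integrable_map_measure hm hRm.aemeasurable).2 ?_
    exact (integrable_siteTime hν hint 0 (floorPt (t • x))).congr
      (ae_of_all _ fun W => (passageTime_eq_siteTime W (t • x)).symm)
  · simp only [hprob, htc]
    exact hmain x l hx hl ξ hξ

end Transfer

lemma measureReal_lt_of_map_eq_expMeasure {Ω : Type*} [MeasurableSpace Ω] {P : Measure Ω}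
    {X : Ω → ℝ} (hX : Measurable X) {α : ℝ} (hα : 0 < α) (h : P.map X = expMeasure α)
    {t : ℝ} (ht : 0 ≤ t) : P.real {ω | t < X ω} = Real.exp (-α * t) := by
  have : IsProbabilityMeasure (expMeasure α) := isProbabilityMeasure_expMeasure hα
  have h1 : P.real {ω | t < X ω} = (expMeasure α).real (Set.Ioi t) := by
    rw [← h, map_measureReal_apply hX measurableSet_Ioi]
    rfl
  have h2 : (Set.Ioi t : Set ℝ) = (Set.Iic t)ᶜ := Set.compl_Iic.symm
  rw [h1, h2, probReal_compl_eq_one_sub measurableSet_Iic, ← cdf_eq_real, cdf_expMeasure_eq hα,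
    if_pos ht]
  ring_nf

end FPP

theorem theorem1 {d : ℕ} (hd : 2 ≤ d) {Ω : Type*} [MeasurableSpace Ω]
    (P : Measure Ω) [IsProbabilityMeasure P] (τ : FPP.Edge d → Ω → ℝ)
    (hmeas : ∀ e, Measurable (τ e))
    (hnonneg : ∀ e, ∀ᵐ ω ∂P, 0 ≤ τ e ω)
    (hindep : iIndepFun τ P)
    (hident : ∀ e e', IdentDistrib (τ e) (τ e') P P) :
    -- stretched-exponential weights
    (∀ (α r c₁ c₂ : ℝ), 0 < α → 0 < r → r ≤ 1 → 0 < c₁ → 0 < c₂ →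
      (∀ e, P.real {ω | τ e ω = 0} < FPP.criticalProb d) →
      (∀ e, ∀ᶠ t : ℝ in atTop,
        c₁ * Real.exp (-α * t ^ r) ≤ P.real {ω | t < τ e ω} ∧
        P.real {ω | t < τ e ω} ≤ c₂ * Real.exp (-α * t ^ r)) →
      ∀ x : Fin d → ℝ, x ≠ 0 →
        -- the time constant is a genuine limit of genuine expectations
        (∀ t : ℝ, Integrable (fun ω => FPP.passageTime (fun e => τ e ω) 0 (t • x)) P) ∧
        Tendsto (fun t : ℝ => t⁻¹ * ∫ ω, FPP.passageTime (fun e => τ e ω) 0 (t • x) ∂P) atTop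
          (𝓝 (FPP.timeConstant P τ x)) ∧
        -- the upper tail large deviation principle
        ∀ ξ : ℝ, 0 < ξ →
          Tendsto (fun n : ℕ => 1 / (n : ℝ) ^ r * Real.log (P.real
              {ω | n * (FPP.timeConstant P τ x + ξ) <
                FPP.passageTime (fun e => τ e ω) 0 ((n : ℝ) • x)}))
            atTop (𝓝 (-2 * d * α * ξ ^ r))) ∧
    -- exponential weights (the Eden growth model)
    (∀ α : ℝ, 0 < α → (∀ e, P.map (τ e) = expMeasure α) →
      ∀ x : Fin d → ℝ, x ≠ 0 → ∀ ξ : ℝ, 0 < ξ →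
        Tendsto (fun n : ℕ => 1 / (n : ℝ) * Real.log (P.real
            {ω | n * (FPP.timeConstant P τ x + ξ) <
              FPP.passageTime (fun e => τ e ω) 0 ((n : ℝ) • x)}))
          atTop (𝓝 (-2 * d * α * ξ))) := by
  refine ⟨fun α r c₁ c₂ hα hr hr1 hc₁ _ _ htail x hx =>
    FPP.upper_tail_of_tail hd hmeas hnonneg hindep hident hα hr hr1 hc₁ htail x hx,
    fun α hα hexp x hx ξ hξ => ?_⟩
  have htail (e : FPP.Edge d) : ∀ᶠ t : ℝ in atTop,
      1 * Real.exp (-α * t ^ (1 : ℝ)) ≤ P.real {ω | t < τ e ω} ∧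
        P.real {ω | t < τ e ω} ≤ 1 * Real.exp (-α * t ^ (1 : ℝ)) := by
    filter_upwards [eventually_ge_atTop 0] with t ht
    rw [FPP.measureReal_lt_of_map_eq_expMeasure (hmeas e) hα (hexp e) ht, Real.rpow_one, one_mul]
    exact ⟨le_rfl, le_rfl⟩
  have := (FPP.upper_tail_of_tail hd hmeas hnonneg hindep hident hα one_pos le_rfl one_pos htail
    x hx).2.2 ξ hξ
  simpa only [Real.rpow_one] using this
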